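/- Let $T>0$, $M\in\mathbb N$, let $\mathcal V\subset\mathbb Z^M$ be finite, $\beta>0$, $p\in(1,\infty)$, and let $F\colon L^1(0,T)^M\to\mathbb R$ be bounded from below, lower semicontinuous and Gâteaux differentiable, where $\|u\|_{L^1}=\int_0^T\|u(t)\|_1\,\mathrm dt$. For $q\in[1,\infty]$ with Hölder conjugate $q'$ put $$\mathrm{TV}_q(u)=\sup\Big\{\int_0^T u^\top\varphi'\,\mathrm dt \;:\; \varphi\in C_c^1(0,T)^M,\ \|\varphi(t)\|_{q'}\le 1\ \forall t\in(0,T)\Big\}\in[0,\infty],$$ and let $U_{ad}=\{u\in L^1(0,T)^M : \mathrm{TV}_2(u)<\infty,\ u(t)\in\mathcal V\text{ for a.a. }t\in(0,T)\}$. Consider the problem $$\text{(P)}\qquad \text{minimize } F(u)+\beta\,\mathrm{TV}_p(u)\quad\text{subject to } u\in L^1(0,T)^M,\ u(t)\in\mathcal V\text{ for a.a. }t\in(0,T).$$ For $n\ge 1$, $a=(a_1,\dots,a_n)$ with $a_j\in\mathbb R^M$, and $t\in\mathbb R^{n-1}$, with the convention $t_0=0$, $t_n=T$, let $$v^{t,a}=a_1\chi_{(t_0,t_1)}+\sum_{j=2}^n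 a_j\chi_{[t_{j-1},t_j)},$$ and consider the switching-time problem $$\mathrm{ST}(n,a)\qquad \text{minimize } F(v^{t,a})\quad\text{subject to } t\in\mathcal F:=\{t\in\mathbb R^{n-1} : 0\le t_1\le\dots\le t_{n-1}\le T\}.$$ A triple $(\hat n,\hat a,\hat t)$ with $\hat n\ge 1$, $\hat a\in\mathcal V^{\hat n}$, $\hat t\in\mathbb R^{\hat n-1}$ is called the full representation of $u\in U_{ad}$ if, with $\hat t_0=0$ and $\hat t_{\hat n}=T$, 1. $u=v^{\hat t,\hat a}$; 2. $0<\hat t_1\le\dots\le\hat t_{\hat n-1}<T$; 3. whenever $1\le i\le j\le\hat n-1$ and $\hat t_{i-1}<\hat t_i=\hat t_j<\hat t_{j+1}$, there is a strictly increasing sequence $\lambda_{i+1},\dots,\lambda_j\in(0,1)$ with $\hat a_k=(1-\lambda_k)\hat a_i+\lambda_k\hat a_{j+1}$ for $k=i+1,\dots,j$, and this sequence contains every $\lambda\in(0,1)$ with $(1-\lambda)\hat a_i+\lambda\hat a_{j+1}\in\mathcal V$. Theorem. Let $u\in U_{ad}$ and let $(\hat n,\hat a,\hat t)$ be its full representation.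 Then $u$ is locally optimal for (P) with respect to the norm of $L^1(0,T)^M$ if and only if $\hat t$ is locally optimal for $\mathrm{ST}(\hat n,\hat a)$. Moreover, there exist $\varepsilon,\eta>0$ such that $$F(w)+\beta\,\mathrm{TV}_p(w)\ \ge\ F(u)+\beta\,\mathrm{TV}_p(u)+\frac\eta2\|w-u\|_{L^1}^2\qquad\forall w\in U_{ad},\ \|w-u\|_{L^1}\le\varepsilon,$$ if and only if there exist $\tilde\varepsilon,\tilde\eta>0$ such that $$F(v^{\hat s,\hat a})\ \ge\ F(u)+\frac{\tilde\eta}2\|\hat s-\hat t\|_2^2\qquad\forall \hat s\in\mathcal F,\ \|\hat s-\hat t\|_2\le\tilde\varepsilon,$$ where $\mathcal F$ is the feasible set of $\mathrm{ST}(\hat n,\hat a)$. -/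

import Mathlib

open MeasureTheory Set Filter Topology
open scoped ENNReal

noncomputable section

namespace SwitchingControl

/-- The space `L¹(0,T)^M`, with the norm `‖u‖ = ∫₀ᵀ ‖u(t)‖₁ dt` (pointwise the `1`-norm). -/
abbrev L1 (M : ℕ) (T : ℝ) : Type :=
  Lp (PiLp 1 (fun _ : Fin M => ℝ)) 1 (volume.restrict (Ioo (0 : ℝ) T))

/-- The `q`-norm of a vector in `ℝ^M`. -/
def vecNorm {M : ℕ} (q : ℝ≥0∞) (v : Fin M → ℝ) : ℝ := ‖WithLp.toLp q v‖

/-- The test functions `φ ∈ C_c¹(0,T)^M` with `‖φ(t)‖_{p'} ≤ 1` for all `t ∈ (0,T)`, where `p'` is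
the Hölder conjugate of `p`. -/
def testFunctions (M : ℕ) (T : ℝ) (p : ℝ≥0∞) : Set (ℝ → Fin M → ℝ) :=
  {φ | ContDiff ℝ 1 φ ∧ HasCompactSupport φ ∧ tsupport φ ⊆ Ioo 0 T ∧
    ∀ t ∈ Ioo 0 T, vecNorm p.conjExponent (φ t) ≤ 1}

/-- The total variation `TV_p(u) ∈ [0,∞]` of `u ∈ L¹(0,T)^M` with respect to the `p`-norm. -/
def TV {M : ℕ} {T : ℝ} (p : ℝ≥0∞) (u : L1 M T) : EReal :=
  ⨆ φ ∈ testFunctions M T p, ((∫ t in Ioo 0 T, ∑ i, u t i * deriv φ t i : ℝ) : EReal)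

/-- A set of integer vectors, viewed inside `ℝ^M`. -/
def controlValues {M : ℕ} (V : Finset (Fin M → ℤ)) : Set (Fin M → ℝ) :=
  (fun ν i => (ν i : ℝ)) '' (V : Set (Fin M → ℤ))

/-- The feasible set of problem (P): `u ∈ L¹(0,T)^M` with `u(t) ∈ V` for a.a. `t ∈ (0,T)`. -/
def feasibleControls {M : ℕ} (T : ℝ) (V : Finset (Fin M → ℤ)) : Set (L1 M T) :=
  {u | ∀ᵐ t ∂(volume.restrict (Ioo (0 : ℝ) T)), (fun i => u t i) ∈ controlValues V}

/-- The space `BV(0,T)^M` of `L¹`-functions of bounded variation. -/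
def BV (M : ℕ) (T : ℝ) : Set (L1 M T) := {u | TV 2 u < ⊤}

/-- The admissible controls: `V`-valued functions in `BV(0,T)^M`. -/
def admissibleControls {M : ℕ} (T : ℝ) (V : Finset (Fin M → ℤ)) : Set (L1 M T) :=
  {u | u ∈ BV M T ∧ u ∈ feasibleControls T V}

/-- The objective `F(u) + β TV_p(u)` of problem (P). -/
def objective {M : ℕ} {T : ℝ} (F : L1 M T → ℝ) (β : ℝ) (p : ℝ≥0∞) (u : L1 M T) : EReal :=
  (F u : EReal) + (β : EReal) * TV p u

/-- Gâteaux differentiability: at every point all directional derivatives exist and are given by a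
bounded linear functional. -/
def GateauxDifferentiable {E : Type*} [NormedAddCommGroup E] [NormedSpace ℝ E] (F : E → ℝ) : Prop :=
  ∀ u : E, ∃ G : E →L[ℝ] ℝ, ∀ h : E, HasLineDerivAt ℝ F (G h) u h

/-- The `n` switching times `t₁, …, tₙ`, together with `t₀ = 0` and `tₙ₊₁ = T`. -/
def knots {n : ℕ} (T : ℝ) (t : EuclideanSpace ℝ (Fin n)) : Fin (n + 2) → ℝ :=
  Fin.cons (α := fun _ => ℝ) 0 (Fin.snoc (α := fun _ => ℝ) (fun i => t i) T)

/-- The `j`-th interval, `j = 0, …, n`, between two consecutive switching times; the first one is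
`(t₀, t₁)`, the others are `[t_j, t_{j+1})`. -/
def knotInterval {n : ℕ} (T : ℝ) (t : EuclideanSpace ℝ (Fin n)) (j : Fin (n + 1)) : Set ℝ :=
  if j = 0 then Ioo (knots T t j.castSucc) (knots T t j.succ)
  else Ico (knots T t j.castSucc) (knots T t j.succ)

/-- The step function `v^{t,a}` with the switching times `t₁, …, tₙ` and the values
`a 0, …, a n`. -/
def stepFun {M n : ℕ} (T : ℝ) (t : EuclideanSpace ℝ (Fin n)) (a : Fin (n + 1) → Fin M → ℝ)
    (x : ℝ) : PiLp 1 (fun _ : Fin M => ℝ) :=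
  ∑ j, (knotInterval T t j).indicator (fun _ => WithLp.toLp 1 (a j)) x

theorem measurableSet_knotInterval {n : ℕ} (T : ℝ) (t : EuclideanSpace ℝ (Fin n))
    (j : Fin (n + 1)) : MeasurableSet (knotInterval T t j) := by
  unfold knotInterval
  split_ifs
  · exact measurableSet_Ioo
  · exact measurableSet_Ico

theorem memLp_stepFun {M n : ℕ} (T : ℝ) (t : EuclideanSpace ℝ (Fin n))
    (a : Fin (n + 1) → Fin M → ℝ) :
    MemLp (stepFun T t a) 1 (volume.restrict (Ioo (0 : ℝ) T)) := by
  unfold stepFun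
  exact memLp_finsetSum _ fun j _ =>
    (memLp_const (WithLp.toLp 1 (a j))).indicator (measurableSet_knotInterval T t j)

/-- The step function `v^{t,a}` as an element of `L¹(0,T)^M`. -/
def stepControl {M n : ℕ} (T : ℝ) (t : EuclideanSpace ℝ (Fin n)) (a : Fin (n + 1) → Fin M → ℝ) :
    L1 M T :=
  (memLp_stepFun T t a).toLp (stepFun T t a)

/-- The feasible set `{t ∈ ℝⁿ | 0 ≤ t₁ ≤ ⋯ ≤ tₙ ≤ T}` of the switching-time problem. -/
def feasibleTimes (n : ℕ) (T : ℝ) : Set (EuclideanSpace ℝ (Fin n)) := {t | Monotone (knots T t)}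

/-- `(n + 1, a, t)` is the full representation of `u`.

The number of pieces is `n + 1`, so there are `n` switching times. The values are indexed from `0`:
`i : Fin n` is the switch from `a i.castSucc` to `a i.succ`, at the time
`t i = knots T t i.succ.castSucc`. -/
structure IsFullRepresentation {M n : ℕ} {T : ℝ} (V : Finset (Fin M → ℤ)) (u : L1 M T)
    (a : Fin (n + 1) → Fin M → ℝ) (t : EuclideanSpace ℝ (Fin n)) : Prop where
  values_mem : ∀ k, a k ∈ controlValues V
  eq_stepControl : u = stepControl T t a
  monotone : Monotone (knots T t)
  /-- All switching times are interior. -/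
  interior : ∀ i, t i ∈ Ioo 0 T
  /-- For each maximal block `i, …, j` of coinciding switching times, the intermediate values run, in
  order, exactly through the points of `V` in the open segment from the value before the block to
  the value after it. -/
  convex : ∀ i j : Fin n, i ≤ j →
    knots T t i.castSucc.castSucc < t i → t i = t j → t j < knots T t j.succ.succ →
    ∃ l : Fin (n + 1) → ℝ,
      StrictMonoOn l (Ioc i.castSucc j.castSucc) ∧
      (∀ k ∈ Ioc i.castSucc j.castSucc,
        l k ∈ Ioo (0 : ℝ) 1 ∧ a k = (1 - l k) • a i.castSucc + l k • a j.succ) ∧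
      ∀ c ∈ Ioo (0 : ℝ) 1, (1 - c) • a i.castSucc + c • a j.succ ∈ controlValues V →
        ∃ k ∈ Ioc i.castSucc j.castSucc, l k = c

/-- Local quadratic growth for (P) at `u`, in `L¹(0,T)^M`. -/
def QuadraticGrowthP {M : ℕ} {T : ℝ} (V : Finset (Fin M → ℤ)) (F : L1 M T → ℝ) (β : ℝ)
    (p : ℝ≥0∞) (u : L1 M T) : Prop :=
  ∃ ε : ℝ, 0 < ε ∧ ∃ η : ℝ, 0 < η ∧ ∀ w ∈ admissibleControls T V, ‖w - u‖ ≤ ε →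
    objective F β p u + ((η / 2 * ‖w - u‖ ^ 2 : ℝ) : EReal) ≤ objective F β p w

/-- Local quadratic growth for the switching-time problem with values `a` at `t`, in the Euclidean
norm. -/
def QuadraticGrowthST {M n : ℕ} {T : ℝ} (F : L1 M T → ℝ) (a : Fin (n + 1) → Fin M → ℝ)
    (t : EuclideanSpace ℝ (Fin n)) : Prop :=
  ∃ ε : ℝ, 0 < ε ∧ ∃ η : ℝ, 0 < η ∧ ∀ s ∈ feasibleTimes n T, ‖s - t‖ ≤ ε →
    F (stepControl T t a) + η / 2 * ‖s - t‖ ^ 2 ≤ F (stepControl T s a)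

end SwitchingControl

end

/-! Near `u` the total variation acts as a discrete penalty. Let `L` be the length, in the `p`-norm,
of the chain of values `a` (`arcLength` at the last index). Distinct points of `V` are at `1`-norm
distance at least 1, so a feasible `w` that is `L¹`-close to `u` must take the value of `u`
somewhere in each nondegenerate interval of `t`. Passing through these values in order costs
variation at least `L`, because the remaining values of `a` lie in order on the segments between
them. Since `TV_p(v^{s,a}) ≤ L` for every feasible `s`, `u` has variation exactly `L` and minimizes
`TV_p` among nearby feasible controls.

There is also a gap. As `V` is finite, positive distances and positive excesses in the triangle
inequality are bounded below by some `γ > 0` (`exists_gap`). If `TV_p(w) < L + γ`, then `w` makes no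
detour: the triangle inequality is an equality, so by strict convexity of the `p`-norm `w` takes
only values of `V` on the segments. The full representation lists all of these, and a step backwards
would again cost `γ`. Hence `w = v^{s,a}` with `|s_k - t_k| ≤ ‖w - u‖` (`exists_stepControl_eq`). If
instead `TV_p(w) ≥ L + γ`, lower semicontinuity of `F` at `u` cannot make up for the loss `βγ`
(`objective_dichotomy`).

So near `u` only the controls `v^{s,a}` compete. Along them the variation never exceeds that of `u`,
and `‖v^{s,a} - u‖` is comparable to `‖s - t‖`. Both equivalences follow.

Pointwise variation is extracted from the dual definition of `TV_p` by testing with mollified step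
functions and passing to the limit at points where local means converge (`exists_good_set`). -/

noncomputable section

namespace SwitchingControl

/-! ### Strict convexity and duality of the `p`-norms -/

section Norms

variable {M : ℕ}

/-- For `1 < p < ∞`, the space `ℝ^M` with the `p`-norm is strictly convex. -/
theorem strictConvexSpace_piLp {p : ℝ≥0∞} [Fact (1 ≤ p)] (hp : 1 < p) (hp' : p < ⊤) :
    StrictConvexSpace ℝ (PiLp p fun _ : Fin M => ℝ) := by
  have hp1 : 1 < p.toReal := by
    rw [← ENNReal.toReal_one]
    exact (ENNReal.toReal_lt_toReal ENNReal.one_ne_top hp'.ne).2 hp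
  have hp0 : 0 < p.toReal := zero_lt_one.trans hp1
  have hsc := strictConvexOn_rpow hp1
  have key : ∀ v : PiLp p fun _ : Fin M => ℝ, ‖v‖ = 1 → ∑ i, |v i| ^ p.toReal = 1 := by
    intro v hv
    rw [PiLp.norm_eq_sum hp0] at hv
    have hnn : 0 ≤ ∑ i, ‖v i‖ ^ p.toReal := Finset.sum_nonneg fun i _ => by positivity
    have := congrArg (· ^ p.toReal) hv
    simp only [one_div, Real.one_rpow] at this
    rwa [Real.rpow_inv_rpow hnn hp0.ne'] at this
  refine StrictConvexSpace.of_norm_add_ne_two fun x y hx hy hxy hadd => ?_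
  have hx1 := key x hx
  have hy1 := key y hy
  have hz1 := key ((1 / 2 : ℝ) • (x + y)) (by rw [norm_smul, hadd]; norm_num)
  obtain ⟨i, hi⟩ : ∃ i, x i ≠ y i := by
    by_contra! h
    exact hxy (PiLp.ext h)
  have hle : ∀ a b : ℝ, |1 / 2 * (a + b)| ≤ 1 / 2 * |a| + 1 / 2 * |b| := fun a b => by
    rw [abs_mul, abs_of_pos (by norm_num : (0 : ℝ) < 1 / 2), ← mul_add]
    exact mul_le_mul_of_nonneg_left (abs_add_le a b) (by norm_num)
  have hweak : ∀ a b : ℝ, |1 / 2 * (a + b)| ^ p.toReal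
      ≤ 1 / 2 * |a| ^ p.toReal + 1 / 2 * |b| ^ p.toReal := fun a b =>
    (Real.rpow_le_rpow (abs_nonneg _) (hle a b) hp0.le).trans
      (hsc.convexOn.2 (abs_nonneg a) (abs_nonneg b) (by norm_num) (by norm_num) (by norm_num))
  have hstrict : |1 / 2 * (x i + y i)| ^ p.toReal
      < 1 / 2 * |x i| ^ p.toReal + 1 / 2 * |y i| ^ p.toReal := by
    -- In a coordinate where `x` and `y` differ, equal moduli mean opposite signs, so the midpoint
    -- vanishes; for different moduli, strict convexity of `r ↦ r ^ p` applies.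
    by_cases h : |x i| = |y i|
    · have hxy' : x i = -y i := (abs_eq_abs.1 h).resolve_left hi
      have hy0 : y i ≠ 0 := fun h0 => hi (by rw [hxy', h0, neg_zero])
      have : 0 < |y i| ^ p.toReal := Real.rpow_pos_of_pos (abs_pos.2 hy0) _
      rw [hxy']
      simp only [neg_add_cancel, mul_zero, abs_zero, Real.zero_rpow hp0.ne', abs_neg]
      linarith
    · exact (Real.rpow_le_rpow (abs_nonneg _) (hle _ _) hp0.le).trans_lt
        (hsc.2 (abs_nonneg (x i)) (abs_nonneg (y i)) h (by norm_num) (by norm_num) (by norm_num))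
  have : ∑ j, |1 / 2 * (x j + y j)| ^ p.toReal
      < ∑ j, (1 / 2 * |x j| ^ p.toReal + 1 / 2 * |y j| ^ p.toReal) :=
    Finset.sum_lt_sum (fun j _ => hweak _ _) ⟨i, Finset.mem_univ i, hstrict⟩
  rw [Finset.sum_add_distrib, ← Finset.mul_sum, ← Finset.mul_sum, hx1, hy1] at this
  simp only [PiLp.smul_apply, PiLp.add_apply, smul_eq_mul] at hz1
  linarith

theorem holderConjugate_toReal {p : ℝ≥0∞} (hp : 1 < p) (hp' : p < ⊤) :
    p.toReal.HolderConjugate p.conjExponent.toReal := by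
  lift p to NNReal using hp'.ne
  have h1 : 1 < p := by exact_mod_cast hp
  rw [← ENNReal.coe_conjExponent h1, ENNReal.coe_toReal, ENNReal.coe_toReal]
  exact_mod_cast NNReal.HolderConjugate.conjExponent h1

theorem vecNorm_eq_sum {q : ℝ≥0∞} (hq : 0 < q.toReal) (v : Fin M → ℝ) :
    vecNorm q v = (∑ i, |v i| ^ q.toReal) ^ (1 / q.toReal) := by
  rw [vecNorm, PiLp.norm_eq_sum hq]
  rfl

theorem vecNorm_nonneg {q : ℝ≥0∞} (hq : 0 < q.toReal) (v : Fin M → ℝ) : 0 ≤ vecNorm q v := by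
  rw [vecNorm_eq_sum hq]
  positivity

theorem sum_mul_le_vecNorm {p : ℝ≥0∞} (hp : 1 < p) (hp' : p < ⊤) (v d : Fin M → ℝ) :
    ∑ i, v i * d i ≤ vecNorm p v * vecNorm p.conjExponent d := by
  have h := holderConjugate_toReal hp hp'
  rw [vecNorm_eq_sum h.pos, vecNorm_eq_sum h.symm.pos]
  exact Real.inner_le_Lp_mul_Lq _ _ _ h

/-- The extremal vector of Hölder's inequality for the moduli `|v i|`, with the signs of `v`
restored. -/
theorem exists_dual_vector {p : ℝ≥0∞} (hp : 1 < p) (hp' : p < ⊤) (v : Fin M → ℝ) :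
    ∃ d : Fin M → ℝ, vecNorm p.conjExponent d ≤ 1 ∧ ∑ i, v i * d i = vecNorm p v := by
  have h := holderConjugate_toReal hp hp'
  obtain ⟨g, hg, hsum⟩ := (NNReal.isGreatest_Lp Finset.univ (fun i => ‖v i‖₊) h).1
  have hsign : ∀ i, ∃ c : ℝ, |c| = 1 ∧ v i * c = |v i| := fun i => by
    rcases le_total 0 (v i) with hi | hi
    · exact ⟨1, by simp, by rw [abs_of_nonneg hi, mul_one]⟩
    · exact ⟨-1, by simp, by rw [abs_of_nonpos hi, mul_neg_one]⟩
  choose c hc hvc using hsign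
  refine ⟨fun i => c i * g i, ?_, ?_⟩
  · rw [vecNorm_eq_sum h.symm.pos]
    have hg' : (∑ i, (g i : ℝ) ^ p.conjExponent.toReal) ≤ 1 := by exact_mod_cast hg
    refine Real.rpow_le_one (by positivity) ?_ (by have := h.symm.pos; positivity)
    simpa [abs_mul, hc] using hg'
  · rw [vecNorm_eq_sum h.pos]
    have hsum' := congrArg NNReal.toReal hsum
    push_cast at hsum'
    simp only [Real.norm_eq_abs] at hsum'
    rw [← hsum']
    exact Finset.sum_congr rfl fun i _ => by rw [← mul_assoc, hvc]

end Norms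

/-! ### From the dual definition of `TV_p` to pointwise variation -/

section GoodPoints

variable {M : ℕ}

/-- The piecewise constant function with the value `d k` between `x k` and `x (k + 1)` for `k < N`,
mollified by a bump function. -/
def mollifiedStep (ρ : ContDiffBump (0 : ℝ)) (N : ℕ) (x : ℕ → ℝ) (d : ℕ → Fin M → ℝ) (s : ℝ) :
    Fin M → ℝ :=
  ∑ k ∈ Finset.range N, (∫ r in (s - x (k + 1))..(s - x k), ρ.normed volume r) • d k

/-- The derivative consists of differences of bumps at consecutive `x k`, so pairing it with `u`
produces differences of local means of `u`. -/
theorem hasDerivAt_mollifiedStep (ρ : ContDiffBump (0 : ℝ)) (N : ℕ) (x : ℕ → ℝ)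
    (d : ℕ → Fin M → ℝ) (s : ℝ) :
    HasDerivAt (mollifiedStep ρ N x d)
      (∑ k ∈ Finset.range N,
        (ρ.normed volume (s - x k) - ρ.normed volume (s - x (k + 1))) • d k) s := by
  have hc : Continuous (ρ.normed volume) := ρ.continuous_normed
  have hH : ∀ y : ℝ, HasDerivAt (fun s : ℝ => ∫ r in (0 : ℝ)..(s - y), ρ.normed volume r)
      (ρ.normed volume (s - y)) s := fun y => by
    simpa using (hc.integral_hasStrictDerivAt 0 (s - y)).hasDerivAt.comp_sub_const s y
  refine HasDerivAt.fun_sum fun k _ => HasDerivAt.smul_const ?_ _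
  refine ((hH (x k)).sub (hH (x (k + 1)))).congr_of_eventuallyEq (Eventually.of_forall fun r => ?_)
  simp only [Pi.sub_apply]
  rw [intervalIntegral.integral_interval_sub_left] <;> exact hc.intervalIntegrable _ _

theorem normed_integral_le_one (ρ : ContDiffBump (0 : ℝ)) {a b : ℝ} (hab : a ≤ b) :
    ∫ r in a..b, ρ.normed volume r ≤ 1 := by
  rw [intervalIntegral.integral_of_le hab, ← ρ.integral_normed (μ := volume)]
  exact setIntegral_le_integral ρ.integrable_normed (Eventually.of_forall ρ.nonneg_normed)

theorem vecNorm_sum_smul_le {q : ℝ≥0∞} [Fact (1 ≤ q)] {ι : Type*} (s : Finset ι) (c : ι → ℝ)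
    (d : ι → Fin M → ℝ) (hc : ∀ k ∈ s, 0 ≤ c k) (hd : ∀ k, vecNorm q (d k) ≤ 1) :
    vecNorm q (∑ k ∈ s, c k • d k) ≤ ∑ k ∈ s, c k := by
  have h : WithLp.toLp q (∑ k ∈ s, c k • d k) = ∑ k ∈ s, c k • WithLp.toLp q (d k) := by
    rw [WithLp.toLp_sum]; rfl
  unfold vecNorm at hd ⊢
  rw [h]
  refine (norm_sum_le _ _).trans (Finset.sum_le_sum fun k hk => ?_)
  rw [norm_smul, Real.norm_of_nonneg (hc k hk)]
  exact mul_le_of_le_one_right (hc k hk) (hd k)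

/-- Each value is a combination of the `d k` with nonnegative weights, which are masses of the bump
over adjacent intervals and so sum to at most 1. Mollification enlarges the support by at most
`ρ.rOut`. -/
theorem mollifiedStep_mem_testFunctions {T : ℝ} {p : ℝ≥0∞} (ρ : ContDiffBump (0 : ℝ)) (N : ℕ)
    {x : ℕ → ℝ} (hx : Monotone x) (h0 : ρ.rOut < x 0) (hT : x N + ρ.rOut < T)
    {d : ℕ → Fin M → ℝ} (hd : ∀ k, vecNorm p.conjExponent (d k) ≤ 1) :
    mollifiedStep ρ N x d ∈ testFunctions M T p := by
  have : Fact (1 ≤ p.conjExponent) := ⟨le_self_add⟩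
  have hc : Continuous (ρ.normed volume) := ρ.continuous_normed
  have hsupp : Function.support (mollifiedStep ρ N x d) ⊆ Icc (x 0 - ρ.rOut) (x N + ρ.rOut) := by
    intro s hs
    by_contra hs'
    refine hs (Finset.sum_eq_zero fun k hk => ?_)
    have hzero : ∀ r ∈ uIcc (s - x (k + 1)) (s - x k), ρ.normed volume r = 0 := fun r hr => by
      have hk' := Finset.mem_range.1 hk
      have h1 : x 0 ≤ x k := hx (Nat.zero_le k)
      have h2 : x (k + 1) ≤ x N := hx hk'
      have h3 : x k ≤ x (k + 1) := hx (Nat.le_succ k)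
      rw [uIcc_of_le (by linarith)] at hr
      by_contra hne
      have hmem : r ∈ Function.support (ρ.normed volume) := hne
      rw [ρ.support_normed_eq, Real.ball_eq_Ioo] at hmem
      exact hs' ⟨by linarith [hr.2, hmem.1], by linarith [hr.1, hmem.2]⟩
    rw [intervalIntegral.integral_congr (g := fun _ => 0) hzero]
    simp
  have hts : tsupport (mollifiedStep ρ N x d) ⊆ Icc (x 0 - ρ.rOut) (x N + ρ.rOut) :=
    closure_minimal hsupp isClosed_Icc
  refine ⟨?_, ?_, ?_, fun s _ => ?_⟩
  · rw [contDiff_one_iff_deriv]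
    refine ⟨fun s => (hasDerivAt_mollifiedStep ρ N x d s).differentiableAt, ?_⟩
    rw [funext fun s => (hasDerivAt_mollifiedStep ρ N x d s).deriv]
    fun_prop
  · exact isCompact_Icc.of_isClosed_subset (isClosed_tsupport _) hts
  · exact hts.trans fun s hs => ⟨by linarith [hs.1], by linarith [hs.2]⟩
  · refine (vecNorm_sum_smul_le _ _ _ (fun k _ => ?_) hd).trans ?_
    · exact intervalIntegral.integral_nonneg (by linarith [hx (Nat.le_succ k)])
        fun r _ => ρ.nonneg_normed r
    · have hsum : ∀ m, ∑ k ∈ Finset.range m, ∫ r in (s - x (k + 1))..(s - x k), ρ.normed volume r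
          = ∫ r in (s - x m)..(s - x 0), ρ.normed volume r := fun m => by
        induction m with
        | zero => simp
        | succ m ih =>
          rw [Finset.sum_range_succ, ih, add_comm]
          exact intervalIntegral.integral_add_adjacent_intervals
            (hc.intervalIntegrable _ _) (hc.intervalIntegrable _ _)
      rw [hsum]
      exact normed_integral_le_one ρ (by linarith [hx (Nat.zero_le N)])

theorem integral_le_TV {T : ℝ} {p : ℝ≥0∞} (u : L1 M T) {φ : ℝ → Fin M → ℝ}
    (hφ : φ ∈ testFunctions M T p) :
    ((∫ t in Ioo 0 T, ∑ i, u t i * deriv φ t i : ℝ) : EReal) ≤ TV p u :=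
  le_iSup₂ (f := fun φ (_ : φ ∈ testFunctions M T p) =>
    ((∫ t in Ioo 0 T, ∑ i, u t i * deriv φ t i : ℝ) : EReal)) φ hφ

theorem integrable_apply {T : ℝ} (u : L1 M T) (i : Fin M) :
    Integrable (fun t => u t i) (volume.restrict (Ioo 0 T)) := by
  have h := L1.integrable_coeFn u
  exact (ContinuousLinearMap.integrable_comp (PiLp.proj (𝕜 := ℝ) 1 (fun _ : Fin M => ℝ) i) h)

/-- The mean of the `i`-th component of `u`, extended by `0`, weighted by a bump centered at `y`. -/
def bumpMean {T : ℝ} (u : L1 M T) (ρ : ContDiffBump (0 : ℝ)) (i : Fin M) (y : ℝ) : ℝ :=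
  ∫ t in Ioo 0 T, ρ.normed volume (t - y) * u t i

theorem integral_mul_deriv_mollifiedStep {T : ℝ} (u : L1 M T) (ρ : ContDiffBump (0 : ℝ)) (N : ℕ)
    (x : ℕ → ℝ) (d : ℕ → Fin M → ℝ) :
    ∫ t in Ioo 0 T, ∑ i, u t i * deriv (mollifiedStep ρ N x d) t i
      = ∑ k ∈ Finset.range N, ∑ i, (bumpMean u ρ i (x k) - bumpMean u ρ i (x (k + 1))) * d k i := by
  have hint : ∀ (i : Fin M) (y : ℝ), Integrable (fun t => ρ.normed volume (t - y) * u t i)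
      (volume.restrict (Ioo 0 T)) := fun i y => by
    obtain ⟨C, hC⟩ := ρ.continuous_normed (μ := volume) |>.bounded_above_of_compact_support
      ρ.hasCompactSupport_normed
    exact (integrable_apply u i).bdd_mul
      ((ρ.continuous_normed.comp (continuous_sub_right y)).aestronglyMeasurable)
      (Eventually.of_forall fun t => hC _)
  have hpt : ∀ t, ∑ i, u t i * deriv (mollifiedStep ρ N x d) t i
      = ∑ k ∈ Finset.range N, ∑ i, (ρ.normed volume (t - x k) * u t i
        - ρ.normed volume (t - x (k + 1)) * u t i) * d k i := fun t => by
    rw [(hasDerivAt_mollifiedStep ρ N x d t).deriv, Finset.sum_comm]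
    refine Finset.sum_congr rfl fun i _ => ?_
    rw [Finset.sum_apply, Finset.mul_sum]
    refine Finset.sum_congr rfl fun k _ => ?_
    simp only [Pi.smul_apply, smul_eq_mul]
    ring
  simp only [hpt]
  have hint' : ∀ k i, Integrable (fun t => (ρ.normed volume (t - x k) * u t i
      - ρ.normed volume (t - x (k + 1)) * u t i) * d k i) (volume.restrict (Ioo 0 T)) := fun k i =>
    ((hint i _).sub (hint i _)).mul_const _
  rw [integral_finsetSum _ fun k _ => integrable_finsetSum _ fun i _ => hint' k i]
  refine Finset.sum_congr rfl fun k _ => ?_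
  rw [integral_finsetSum _ fun i _ => hint' k i]
  refine Finset.sum_congr rfl fun i _ => ?_
  rw [integral_mul_const, integral_sub (hint i _) (hint i _)]
  rfl

/-- A sequence of bump functions shrinking to the origin. -/
def shrinkingBump (m : ℕ) : ContDiffBump (0 : ℝ) where
  rIn := 1 / (2 * (m + 1))
  rOut := 1 / (m + 1)
  rIn_pos := by positivity
  rIn_lt_rOut := by
    apply one_div_lt_one_div_of_lt <;> linarith [(Nat.cast_nonneg m : (0 : ℝ) ≤ m)]

theorem tendsto_shrinkingBump_rOut : Tendsto (fun m => (shrinkingBump m).rOut) atTop (𝓝 0) :=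
  tendsto_one_div_add_atTop_nhds_zero_nat

/-- Lebesgue differentiation for mollifiers. The ratio of outer to inner radius is constantly 2,
which is the bound `K` needed there. -/
theorem ae_tendsto_bumpMean {T : ℝ} (u : L1 M T) :
    ∀ᵐ y ∂volume.restrict (Ioo 0 T), ∀ i,
      Tendsto (fun m => bumpMean u (shrinkingBump m) i y) atTop (𝓝 (u y i)) := by
  rw [ae_all_iff]
  intro i
  have hg : Integrable ((Ioo 0 T).indicator fun t => u t i) :=
    (integrable_indicator_iff measurableSet_Ioo).2 (integrable_apply u i)
  have h := ContDiffBump.ae_convolution_tendsto_right_of_locallyIntegrable (K := 2)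
    tendsto_shrinkingBump_rOut (Eventually.of_forall fun m => le_of_eq (by
      simp only [shrinkingBump]; field_simp)) hg.locallyIntegrable
  filter_upwards [ae_restrict_of_ae h, ae_restrict_mem measurableSet_Ioo] with y hy hyT
  rw [indicator_of_mem hyT] at hy
  refine hy.congr fun m => ?_
  -- The convolution carries the reflected argument; the bump is even, so this is the local mean.
  rw [convolution_eq_swap, bumpMean, ← integral_indicator measurableSet_Ioo]
  refine integral_congr_ae (Eventually.of_forall fun t => ?_)
  simp only [ContinuousLinearMap.lsmul_apply, smul_eq_mul]
  rw [← ContDiffBump.normed_neg, neg_sub, indicator_mul_right]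

/-- At a.e. point of `(0,T)`, averages of `u` converge, so that `TV_p(u)` bounds the pointwise
variation of `u` along such points. -/
theorem exists_good_set {T : ℝ} {p : ℝ≥0∞} (hp : 1 < p) (hp' : p < ⊤) (u : L1 M T) :
    ∃ G ⊆ Ioo 0 T, (∀ᵐ y ∂volume.restrict (Ioo 0 T), y ∈ G) ∧
      ∀ (N : ℕ) (x : ℕ → ℝ), Monotone x → (∀ k, x k ∈ G) →
        ((∑ k ∈ Finset.range N, vecNorm p (fun i => u (x k) i - u (x (k + 1)) i) : ℝ) : EReal)
          ≤ TV p u := by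
  refine ⟨{y | y ∈ Ioo 0 T ∧ ∀ i, Tendsto (fun m => bumpMean u (shrinkingBump m) i y) atTop
    (𝓝 (u y i))}, fun y hy => hy.1, ?_, fun N x hx hG => ?_⟩
  · filter_upwards [ae_tendsto_bumpMean u, ae_restrict_mem measurableSet_Ioo] with y h1 h2
    exact ⟨h2, h1⟩
  -- The direction `d k` is dual to the `k`-th jump, so in the limit the pairing with `u` becomes
  -- the sum of the norms of the jumps.
  choose d hd hdsum using fun k => exists_dual_vector hp hp' fun i => u (x k) i - u (x (k + 1)) i
  have hlim : Tendsto (fun m => ∑ k ∈ Finset.range N, ∑ i,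
      (bumpMean u (shrinkingBump m) i (x k) - bumpMean u (shrinkingBump m) i (x (k + 1))) * d k i)
      atTop (𝓝 (∑ k ∈ Finset.range N, ∑ i, (u (x k) i - u (x (k + 1)) i) * d k i)) :=
    tendsto_finsetSum _ fun k _ => tendsto_finsetSum _ fun i _ =>
      (((hG k).2 i).sub ((hG (k + 1)).2 i)).mul_const _
  simp only [hdsum] at hlim
  refine le_of_tendsto ((continuous_coe_real_ereal.tendsto _).comp hlim) ?_
  -- Once the bumps at `x 0` and `x N` fit inside `(0,T)`, the mollified step is an admissible test
  -- function.
  have h1 := tendsto_shrinkingBump_rOut.eventually (gt_mem_nhds (hG 0).1.1)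
  have h2 := tendsto_shrinkingBump_rOut.eventually (gt_mem_nhds (sub_pos.2 (hG N).1.2))
  filter_upwards [h1, h2] with m h1 h2
  simp only [Function.comp_apply]
  rw [← integral_mul_deriv_mollifiedStep]
  exact integral_le_TV u (mollifiedStep_mem_testFunctions _ N hx h1 (by linarith) hd)

theorem TV_nonneg {T : ℝ} (p : ℝ≥0∞) (u : L1 M T) : 0 ≤ TV p u := by
  have h : (0 : ℝ → Fin M → ℝ) ∈ testFunctions M T p := by
    refine ⟨contDiff_const, HasCompactSupport.zero, by simp, fun t _ => ?_⟩
    have : Fact (1 ≤ p.conjExponent) := ⟨le_self_add⟩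
    simp [vecNorm]
  simpa using integral_le_TV u h

/-- A function with `TV_p(u) < ∞` has, on a set of full measure, a cumulative variation
function that is controlled by `TV_p(u)`. -/
theorem exists_cumulative_variation {T : ℝ} {p : ℝ≥0∞} (hp : 1 < p) (hp' : p < ⊤) (u : L1 M T)
    {C : ℝ} (hC : TV p u ≤ C) :
    ∃ G ⊆ Ioo 0 T, (∀ᵐ y ∂volume.restrict (Ioo 0 T), y ∈ G) ∧ ∃ D : ℝ → ℝ,
      ∀ x ∈ G, ∀ y ∈ G, x ≤ y →
        vecNorm p (fun i => u x i - u y i) ≤ D y - D x ∧ D y - D x ≤ C := by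
  have : Fact (1 ≤ p) := ⟨hp.le⟩
  obtain ⟨G, hGT, hG, hvar⟩ := exists_good_set hp hp' u
  refine ⟨G, hGT, hG, ?_⟩
  set f : ℝ → PiLp p fun _ : Fin M => ℝ := fun y => WithLp.toLp p fun i => u y i with hf
  have hdist : ∀ x y, dist (f x) (f y) = vecNorm p (fun i => u x i - u y i) := fun x y => by
    rw [dist_eq_norm]; rfl
  have hle : eVariationOn f G ≤ ENNReal.ofReal C := by
    refine iSup_le fun ⟨N, x, hx, hxG⟩ => ?_
    have h := (hvar N x hx hxG).trans hC
    rw [EReal.coe_le_coe_iff] at h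
    have hed : ∀ a b, edist (f a) (f b) = ENNReal.ofReal (vecNorm p fun i => u b i - u a i) :=
      fun a b => by rw [edist_dist, dist_comm, hdist]
    simp only [hed]
    rw [← ENNReal.ofReal_sum_of_nonneg fun k _ => by rw [← hdist]; exact dist_nonneg]
    exact ENNReal.ofReal_le_ofReal h
  have hbv : BoundedVariationOn f G := ne_top_of_le_ne_top ENNReal.ofReal_ne_top hle
  have hC0 : 0 ≤ C := by exact_mod_cast (TV_nonneg p u).trans hC
  rcases G.eq_empty_or_nonempty with rfl | ⟨b, hb⟩
  · exact ⟨0, by simp⟩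
  refine ⟨variationOnFromTo f G b, fun x hx y hy hxy => ?_⟩
  have hadd := variationOnFromTo.add hbv.locallyBoundedVariationOn hb hx hy
  rw [← hadd, add_sub_cancel_left, variationOnFromTo.eq_of_le f G hxy, ← hdist]
  constructor
  · exact BoundedVariationOn.dist_le (hbv.mono inter_subset_left) ⟨hx, le_rfl, hxy⟩
      ⟨hy, hxy, le_rfl⟩
  · exact ENNReal.toReal_le_of_le_ofReal hC0 ((eVariationOn.mono f inter_subset_left).trans hle)

end GoodPoints

/-! ### Step functions: jump form, `L¹`-distance and total variation -/

section StepFunctions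

variable {M n : ℕ} {T : ℝ}

@[simp]
theorem knots_zero (t : EuclideanSpace ℝ (Fin n)) : knots T t 0 = 0 := rfl

@[simp]
theorem knots_last (t : EuclideanSpace ℝ (Fin n)) : knots T t (Fin.last (n + 1)) = T := by
  rw [knots, ← Fin.succ_last, Fin.cons_succ, Fin.snoc_last]

theorem knots_succ_castSucc (t : EuclideanSpace ℝ (Fin n)) (i : Fin n) :
    knots T t i.succ.castSucc = t i := by
  rw [knots, ← Fin.succ_castSucc, Fin.cons_succ, Fin.snoc_castSucc]

theorem knots_castSucc_succ (t : EuclideanSpace ℝ (Fin n)) (i : Fin n) :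
    knots T t i.castSucc.succ = t i := by
  rw [Fin.succ_castSucc, knots_succ_castSucc]

theorem knot_index_cases (x : Fin (n + 2)) :
    x = 0 ∨ x = Fin.last (n + 1) ∨ ∃ i : Fin n, x = i.succ.castSucc := by
  rcases Fin.eq_castSucc_or_eq_last x with ⟨y, rfl⟩ | rfl
  · rcases Fin.eq_zero_or_eq_succ y with rfl | ⟨i, rfl⟩
    · exact Or.inl rfl
    · exact Or.inr (Or.inr ⟨i, rfl⟩)
  · exact Or.inr (Or.inl rfl)

theorem monotone_knots {t : EuclideanSpace ℝ (Fin n)} (hT : 0 ≤ T) (ht : ∀ i, t i ∈ Icc 0 T)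
    (hmono : ∀ i j, i ≤ j → t i ≤ t j) : Monotone (knots T t) := by
  intro x y hxy
  rcases knot_index_cases x with rfl | rfl | ⟨i, rfl⟩
  · rcases knot_index_cases y with rfl | rfl | ⟨j, rfl⟩
    · rfl
    · simpa using hT
    · rw [knots_zero, knots_succ_castSucc]; exact (ht j).1
  · rw [Fin.last_le_iff.1 hxy]
  · rcases knot_index_cases y with rfl | rfl | ⟨j, rfl⟩
    · exact absurd hxy (by simp)
    · rw [knots_last, knots_succ_castSucc]; exact (ht i).2
    · rw [knots_succ_castSucc, knots_succ_castSucc]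
      exact hmono i j (by simpa using hxy)

theorem mem_Icc_of_monotone_knots {t : EuclideanSpace ℝ (Fin n)} (ht : Monotone (knots T t))
    (i : Fin n) : t i ∈ Icc 0 T := by
  rw [← knots_succ_castSucc (T := T)]
  exact ⟨by simpa using ht (Fin.zero_le i.succ.castSucc),
    by simpa using ht (Fin.le_last i.succ.castSucc)⟩

theorem Ioo_subset_knotInterval (t : EuclideanSpace ℝ (Fin n)) (j : Fin (n + 1)) :
    Ioo (knots T t j.castSucc) (knots T t j.succ) ⊆ knotInterval T t j := by
  unfold knotInterval
  split_ifs
  · exact Subset.rfl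
  · exact Ioo_subset_Ico_self

theorem knotInterval_subset_Ico (t : EuclideanSpace ℝ (Fin n)) (j : Fin (n + 1)) :
    knotInterval T t j ⊆ Ico (knots T t j.castSucc) (knots T t j.succ) := by
  unfold knotInterval
  split_ifs
  · exact Ioo_subset_Ico_self
  · exact Subset.rfl

theorem mem_knotInterval_iff {t : EuclideanSpace ℝ (Fin n)} {z : ℝ} (hz : 0 < z)
    (j : Fin (n + 1)) :
    z ∈ knotInterval T t j ↔ knots T t j.castSucc ≤ z ∧ z < knots T t j.succ := by
  unfold knotInterval
  split_ifs with h
  · subst h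
    simp only [Fin.castSucc_zero, knots_zero, mem_Ioo, hz, hz.le]
  · rfl

theorem stepFun_eq_of_mem {t : EuclideanSpace ℝ (Fin n)} (ht : Monotone (knots T t))
    (a : Fin (n + 1) → Fin M → ℝ) {z : ℝ} {k : Fin (n + 1)} (hz : z ∈ knotInterval T t k) :
    stepFun T t a z = WithLp.toLp 1 (a k) := by
  unfold stepFun
  rw [Finset.sum_eq_single_of_mem k (Finset.mem_univ k), indicator_of_mem hz]
  intro j _ hj
  refine indicator_of_notMem (fun hz' => ?_) _
  have h1 := knotInterval_subset_Ico t k hz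
  have h2 := knotInterval_subset_Ico t j hz'
  rcases lt_or_gt_of_ne hj with h | h
  · exact absurd (ht (Fin.succ_le_castSucc_iff.2 h)) (not_le.2 (h1.1.trans_lt h2.2))
  · exact absurd (ht (Fin.succ_le_castSucc_iff.2 h)) (not_le.2 (h2.1.trans_lt h1.2))

theorem exists_mem_knotInterval (t : EuclideanSpace ℝ (Fin n)) {z : ℝ} (hz : z ∈ Ioo 0 T) :
    ∃ q, z ∈ knotInterval T t q := by
  simp only [mem_knotInterval_iff hz.1]
  by_contra! h
  have : ∀ j : Fin (n + 2), knots T t j ≤ z := fun j => by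
    induction j using Fin.induction with
    | zero => simpa using hz.1.le
    | succ i ih => exact h i ih
  exact absurd (this (Fin.last _)) (by simpa using hz.2)

/-- Summation by parts: for ordered knots the indicator of an interval is a difference of indicators
of half-lines. In this form each switching time enters through a single jump. -/
theorem stepFun_eq_add_sum {t : EuclideanSpace ℝ (Fin n)} (ht : Monotone (knots T t))
    (a : Fin (n + 1) → Fin M → ℝ) {z : ℝ} (hz : z ∈ Ioo 0 T) :
    stepFun T t a z = WithLp.toLp 1 (a 0)
      + ∑ i, (Ici (t i)).indicator (fun _ => WithLp.toLp 1 (a i.succ - a i.castSucc)) z := by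
  have hj : ∀ j : Fin (n + 1), (knotInterval T t j).indicator (fun _ => WithLp.toLp 1 (a j)) z
      = (Ici (knots T t j.castSucc)).indicator (fun _ => WithLp.toLp 1 (a j)) z
        - (Ici (knots T t j.succ)).indicator (fun _ => WithLp.toLp 1 (a j)) z := fun j => by
    have hle := ht (Fin.castSucc_lt_succ (i := j)).le
    simp only [indicator, mem_knotInterval_iff hz.1, mem_Ici]
    by_cases h1 : knots T t j.castSucc ≤ z <;> by_cases h2 : knots T t j.succ ≤ z
    · simp [h1, h2]
    · simp [h1, h2, not_le.1 h2]
    · exact absurd (hle.trans h2) h1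
    · simp [h1, h2]
  unfold stepFun
  simp only [hj, Finset.sum_sub_distrib]
  rw [Fin.sum_univ_succ, Fin.sum_univ_castSucc (fun j : Fin (n + 1) =>
    (Ici (knots T t j.succ)).indicator (fun _ => WithLp.toLp 1 (a j)) z)]
  simp only [Fin.castSucc_zero, knots_zero, Fin.succ_last, knots_last, knots_succ_castSucc,
    knots_castSucc_succ]
  rw [indicator_of_mem (show z ∈ Ici 0 from hz.1.le),
    indicator_of_notMem (show z ∉ Ici T from not_le.2 hz.2), add_zero, add_sub_assoc,
    ← Finset.sum_sub_distrib]
  congr 1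
  refine Finset.sum_congr rfl fun i _ => ?_
  by_cases h : z ∈ Ici (t i) <;> simp [h]

theorem coeFn_stepControl (t : EuclideanSpace ℝ (Fin n)) (a : Fin (n + 1) → Fin M → ℝ) :
    stepControl T t a =ᵐ[volume.restrict (Ioo 0 T)] stepFun T t a :=
  (memLp_stepFun T t a).coeFn_toLp

theorem norm_sub_eq_integral (u w : L1 M T) : ‖w - u‖ = ∫ z in Ioo 0 T, ‖w z - u z‖ := by
  rw [L1.norm_eq_integral_norm]
  exact integral_congr_ae ((Lp.coeFn_sub w u).mono fun z hz => by
    simp only [hz, Pi.sub_apply])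

/-- In jump form, the `i`-th terms for `s` and `t` differ only between `s i` and `t i`. -/
theorem norm_stepControl_sub_le {s t : EuclideanSpace ℝ (Fin n)} (hs : Monotone (knots T s))
    (ht : Monotone (knots T t)) (a : Fin (n + 1) → Fin M → ℝ) :
    ‖stepControl T s a - stepControl T t a‖
      ≤ ∑ i, |s i - t i| * vecNorm 1 (a i.succ - a i.castSucc) := by
  rw [norm_sub_eq_integral]
  have hint : ∀ i, Integrable ((uIcc (s i) (t i)).indicator fun _ =>
      vecNorm 1 (a i.succ - a i.castSucc)) (volume.restrict (Ioo 0 T)) := fun i =>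
    (integrable_const _).indicator measurableSet_uIcc
  calc ∫ z in Ioo 0 T, ‖stepControl T s a z - stepControl T t a z‖
      ≤ ∫ z in Ioo 0 T, ∑ i, (uIcc (s i) (t i)).indicator
          (fun _ => vecNorm 1 (a i.succ - a i.castSucc)) z := by
        refine integral_mono_ae (L1.integrable_coeFn _ |>.sub (L1.integrable_coeFn _)).norm
          (integrable_finsetSum _ fun i _ => hint i) ?_
        filter_upwards [coeFn_stepControl s a, coeFn_stepControl t a,
          ae_restrict_mem measurableSet_Ioo] with z h1 h2 hz
        rw [h1, h2, stepFun_eq_add_sum hs a hz, stepFun_eq_add_sum ht a hz, add_sub_add_left_eq_sub,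
          ← Finset.sum_sub_distrib]
        refine (norm_sum_le _ _).trans (Finset.sum_le_sum fun i _ => ?_)
        simp only [indicator, mem_Ici, mem_uIcc]
        have h0 : 0 ≤ vecNorm 1 (a i.succ - a i.castSucc) := vecNorm_nonneg (by simp) _
        split_ifs with h1 h2 h3 h4 h5 h6
        · simpa using h0
        · simp
        · simp [vecNorm]
        · exact absurd (Or.inl ⟨h1, (not_le.1 h2).le⟩) h4
        · simp [vecNorm, norm_sub_rev]
        · exact absurd (Or.inr ⟨h5, (not_le.1 h1).le⟩) h6
        · simpa using h0
        · simp
    _ = ∑ i, ∫ z in Ioo 0 T, (uIcc (s i) (t i)).indicator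
          (fun _ => vecNorm 1 (a i.succ - a i.castSucc)) z :=
        integral_finsetSum _ fun i _ => hint i
    _ ≤ _ := by
        refine Finset.sum_le_sum fun i _ => ?_
        rw [integral_indicator_const _ measurableSet_uIcc, smul_eq_mul]
        refine mul_le_mul_of_nonneg_right ?_ (vecNorm_nonneg (by simp) _)
        rw [measureReal_restrict_apply measurableSet_uIcc]
        refine (measureReal_mono inter_subset_left (by simp [uIcc])).trans ?_
        rw [uIcc, Real.volume_real_Icc_of_le (by simp), max_sub_min_eq_abs, abs_sub_comm]

/-- Turns the unit separation of points of `V` into bounds on lengths; all lower estimates of `‖w -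
u‖` rest on it. -/
theorem sub_le_norm_sub {u w : L1 M T} {b c : ℝ} (hbc : Ioo b c ⊆ Ioo 0 T)
    (h : ∀ᵐ z ∂volume.restrict (Ioo 0 T), z ∈ Ioo b c → 1 ≤ ‖w z - u z‖) : c - b ≤ ‖w - u‖ := by
  rcases le_total c b with hcb | hcb
  · exact (sub_nonpos.2 hcb).trans (norm_nonneg _)
  rw [norm_sub_eq_integral]
  have hI : ∫ z in Ioo 0 T, (Ioo b c).indicator (fun _ => (1 : ℝ)) z = c - b := by
    rw [integral_indicator_const _ measurableSet_Ioo, smul_eq_mul, mul_one,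
      measureReal_restrict_apply measurableSet_Ioo, inter_eq_left.2 hbc,
      Real.volume_real_Ioo_of_le hcb]
  rw [← hI]
  refine integral_mono_ae ((integrable_const _).indicator measurableSet_Ioo)
    (L1.integrable_coeFn w |>.sub (L1.integrable_coeFn u)).norm ?_
  filter_upwards [h] with z hz
  by_cases hzm : z ∈ Ioo b c
  · rw [indicator_of_mem hzm]; exact hz hzm
  · rw [indicator_of_notMem hzm]; exact norm_nonneg _

theorem testFunctions_eq_zero {p : ℝ≥0∞} {φ : ℝ → Fin M → ℝ} (hφ : φ ∈ testFunctions M T p)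
    {z : ℝ} (hz : z ∉ Ioo 0 T) : φ z = 0 :=
  image_eq_zero_of_notMem_tsupport fun h => hz (hφ.2.2.1 h)

theorem vecNorm_testFunctions_le_one {p : ℝ≥0∞} {φ : ℝ → Fin M → ℝ}
    (hφ : φ ∈ testFunctions M T p) (z : ℝ) : vecNorm p.conjExponent (-φ z) ≤ 1 := by
  have : Fact (1 ≤ p.conjExponent) := ⟨le_self_add⟩
  by_cases hz : z ∈ Ioo 0 T
  · rw [vecNorm, WithLp.toLp_neg, norm_neg]
    exact hφ.2.2.2 z hz
  · simp [testFunctions_eq_zero hφ hz, vecNorm]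

/-- The fundamental theorem of calculus on `[s, T]`, with `φ T = 0`. -/
theorem integral_deriv_testFunctions {p : ℝ≥0∞} {φ : ℝ → Fin M → ℝ}
    (hφ : φ ∈ testFunctions M T p) {s : ℝ} (hs : s ∈ Icc 0 T) (i : Fin M) :
    ∫ z in Ioo 0 T, (Ici s).indicator (fun z => deriv φ z i) z = -φ s i := by
  have hae : (Ioo 0 T ∩ Ici s : Set ℝ) =ᵐ[volume] Ioc s T := by
    have h : (Ioc 0 T ∩ Ioi s : Set ℝ) = Ioc s T := by rw [Ioc_inter_Ioi, max_eq_right hs.1]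
    rw [← h]
    exact Ioo_ae_eq_Ioc.inter Ioi_ae_eq_Ici.symm
  have hd : ∀ z, HasDerivAt (fun z => φ z i) (deriv φ z i) z := fun z =>
    hasDerivAt_pi.1 ((hφ.1.differentiable one_ne_zero z).hasDerivAt) i
  rw [setIntegral_indicator measurableSet_Ici, setIntegral_congr_set hae,
    ← intervalIntegral.integral_of_le hs.2,
    intervalIntegral.integral_eq_sub_of_hasDerivAt fun z _ => hd z]
  · simp [testFunctions_eq_zero hφ (z := T) (by simp)]
  · exact ((continuous_apply i).comp (hφ.1.continuous_deriv_one)).intervalIntegrable _ _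

/-- The total variation of the values `a`, up to index `k`. -/
def arcLength (p : ℝ≥0∞) (a : Fin (n + 1) → Fin M → ℝ) (k : Fin (n + 1)) : ℝ :=
  ∑ i : Fin n with i.castSucc < k, vecNorm p (a i.succ - a i.castSucc)

theorem arcLength_zero (p : ℝ≥0∞) (a : Fin (n + 1) → Fin M → ℝ) : arcLength p a 0 = 0 := by
  simp [arcLength]

theorem arcLength_last (p : ℝ≥0∞) (a : Fin (n + 1) → Fin M → ℝ) :
    arcLength p a (Fin.last n) = ∑ i : Fin n, vecNorm p (a i.succ - a i.castSucc) := by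
  simp [arcLength, Fin.castSucc_lt_last]

theorem arcLength_succ (p : ℝ≥0∞) (a : Fin (n + 1) → Fin M → ℝ) (i : Fin n) :
    arcLength p a i.succ = arcLength p a i.castSucc + vecNorm p (a i.succ - a i.castSucc) := by
  have h : (Finset.univ.filter fun j : Fin n => j.castSucc < i.succ)
      = insert i (Finset.univ.filter fun j : Fin n => j.castSucc < i.castSucc) := by
    ext j
    simp [Fin.castSucc_lt_succ_iff, le_iff_eq_or_lt]
  rw [arcLength, h, Finset.sum_insert (by simp), add_comm]
  rfl

/-- In jump form, the integral against `φ'` is the sum of the jumps paired with `-φ (s k)`, and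
Hölder bounds each term. The initial value drops out since `φ 0 = 0`. Coinciding switching times are
allowed, hence only an inequality. -/
theorem TV_stepControl_le {p : ℝ≥0∞} (hp : 1 < p) (hp' : p < ⊤) {s : EuclideanSpace ℝ (Fin n)}
    (hs : Monotone (knots T s)) (a : Fin (n + 1) → Fin M → ℝ) :
    TV p (stepControl T s a) ≤ arcLength p a (Fin.last n) := by
  refine iSup₂_le fun φ hφ => ?_
  rw [EReal.coe_le_coe_iff, arcLength_last]
  have hT0 : (0 : ℝ) ∈ Icc 0 T := ⟨le_rfl, by simpa using hs (Fin.zero_le (Fin.last (n + 1)))⟩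
  have hint : ∀ (r : ℝ) (i : Fin M), Integrable ((Ici r).indicator fun z => deriv φ z i)
      (volume.restrict (Ioo 0 T)) := fun r i =>
    (((continuous_apply i).comp hφ.1.continuous_deriv_one).continuousOn.integrableOn_Icc.mono_set
      Ioo_subset_Icc_self).indicator measurableSet_Ici
  have hpt : ∀ᵐ z ∂volume.restrict (Ioo 0 T), ∑ i, stepControl T s a z i * deriv φ z i
      = ∑ i, (a 0 i * (Ici 0).indicator (fun z => deriv φ z i) z
        + ∑ k : Fin n, (a k.succ i - a k.castSucc i)
          * (Ici (s k)).indicator (fun z => deriv φ z i) z) := by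
    filter_upwards [coeFn_stepControl s a, ae_restrict_mem measurableSet_Ioo] with z h1 hz
    refine Finset.sum_congr rfl fun i _ => ?_
    rw [h1, stepFun_eq_add_sum hs a hz, indicator_of_mem (show z ∈ Ici 0 from hz.1.le),
      PiLp.add_apply, add_mul, PiLp.toLp_apply, WithLp.ofLp_sum, Finset.sum_apply, Finset.sum_mul]
    congr 1
    refine Finset.sum_congr rfl fun k _ => ?_
    by_cases h : z ∈ Ici (s k)
    · simp [indicator_of_mem h]
    · simp [indicator_of_notMem h]
  have hint' : ∀ i, Integrable (fun z => ∑ k : Fin n, (a k.succ i - a k.castSucc i)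
      * (Ici (s k)).indicator (fun z => deriv φ z i) z) (volume.restrict (Ioo 0 T)) := fun i =>
    integrable_finsetSum _ fun k _ => (hint _ i).const_mul _
  rw [integral_congr_ae hpt, integral_finsetSum _ fun i _ => by
    exact ((hint 0 i).const_mul (a 0 i)).add (hint' i)]
  have hi : ∀ i, ∫ z in Ioo 0 T, (a 0 i * (Ici 0).indicator (fun z => deriv φ z i) z
        + ∑ k : Fin n, (a k.succ i - a k.castSucc i)
          * (Ici (s k)).indicator (fun z => deriv φ z i) z)
      = ∑ k : Fin n, (a k.succ i - a k.castSucc i) * (-φ (s k) i) := fun i => by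
    rw [integral_add ((hint 0 i).const_mul _) (hint' i), integral_const_mul,
      integral_deriv_testFunctions hφ hT0, testFunctions_eq_zero hφ (by simp),
      integral_finsetSum _ fun k _ => (hint _ i).const_mul _]
    simp only [Pi.zero_apply, neg_zero, mul_zero, zero_add, integral_const_mul]
    exact Finset.sum_congr rfl fun k _ => by
      rw [integral_deriv_testFunctions hφ (mem_Icc_of_monotone_knots hs k)]
  simp only [hi]
  rw [Finset.sum_comm]
  refine Finset.sum_le_sum fun k _ => ?_
  refine (sum_mul_le_vecNorm hp hp' (a k.succ - a k.castSucc) (-φ (s k))).trans ?_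
  exact mul_le_of_le_one_right (vecNorm_nonneg (holderConjugate_toReal hp hp').pos _)
    (vecNorm_testFunctions_le_one hφ _)

end StepFunctions

/-! ### Chains of values and blocks of coinciding switching times -/

section Chains

variable {M n : ℕ} {T : ℝ}

/-- `J < K` are consecutive indices with the property `A`. -/
def Consecutive (A : Fin (n + 1) → Prop) (J K : Fin (n + 1)) : Prop :=
  J < K ∧ A J ∧ A K ∧ ∀ q, J < q → q < K → ¬A q

theorem Consecutive.le_left {A : Fin (n + 1) → Prop} {J K q : Fin (n + 1)} (h : Consecutive A J K)
    (hq : A q) (hqK : q < K) : q ≤ J :=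
  not_lt.1 fun hJq => h.2.2.2 q hJq hqK hq

theorem Consecutive.right_le {A : Fin (n + 1) → Prop} {J K q : Fin (n + 1)} (h : Consecutive A J K)
    (hq : A q) (hJq : J < q) : K ≤ q :=
  not_lt.1 fun hqK => h.2.2.2 q hJq hqK hq

theorem exists_consecutive {A : Fin (n + 1) → Prop} (h0 : A 0) (hlast : A (Fin.last n))
    (i : Fin n) : ∃ J K, Consecutive A J K ∧ J ≤ i.castSucc ∧ i.succ ≤ K := by
  classical
  have h1 : (Finset.univ.filter fun q => A q ∧ q ≤ i.castSucc).Nonempty :=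
    ⟨0, by simp [h0]⟩
  have h2 : (Finset.univ.filter fun q => A q ∧ i.succ ≤ q).Nonempty :=
    ⟨Fin.last n, by simp [hlast, Fin.le_last]⟩
  obtain ⟨J, hJ, hJmax⟩ := Finset.exists_max_image _ id h1
  obtain ⟨K, hK, hKmin⟩ := Finset.exists_min_image _ id h2
  simp only [Finset.mem_filter, Finset.mem_univ, true_and, id, and_imp] at hJ hJmax hK hKmin
  refine ⟨J, K, ⟨(hJ.2.trans_lt Fin.castSucc_lt_succ).trans_le hK.2, hJ.1, hK.1,
    fun q hq1 hq2 hq => ?_⟩, hJ.2, hK.2⟩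
  rcases le_or_gt q i.castSucc with h | h
  · exact absurd (hJmax q hq h) (not_le.2 hq1)
  · exact absurd (hKmin q hq (Fin.castSucc_lt_iff_succ_le.1 h)) (not_le.2 hq2)

section Chain

variable {E : Type*} [MetricSpace E] {A : Fin (n + 1) → Prop} {α : Fin (n + 1) → E}
  {Λ : Fin (n + 1) → ℝ} {G : Set ℝ} {f : ℝ → E} {m : Fin (n + 1) → ℝ}

/-- Induction on `K`, stepping back to the preceding index with property `A`: between two
consecutive marks `f` varies at least by the distance of its values there, which is the increment of
`Λ`. -/
theorem sub_le_cumulative_variation {D : ℝ → ℝ} (h0 : A 0) (hlast : A (Fin.last n))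
    (hgeo : ∀ J K, Consecutive A J K → ∀ i j, J ≤ i → i ≤ j → j ≤ K →
      dist (α i) (α j) = Λ j - Λ i)
    (hmG : ∀ J, A J → m J ∈ G) (hfm : ∀ J, A J → f (m J) = α J)
    (hm : ∀ J K, A J → A K → J < K → m J < m K)
    (hD : ∀ x ∈ G, ∀ y ∈ G, x ≤ y → dist (f x) (f y) ≤ D y - D x) :
    ∀ K, A K → ∀ J, A J → J ≤ K → Λ K - Λ J ≤ D (m K) - D (m J) := by
  intro K
  induction K using WellFoundedLT.induction with
  | ind K ih =>
    intro hK J hJ hJK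
    rcases hJK.eq_or_lt with rfl | hlt
    · simp
    obtain ⟨i, rfl⟩ := Fin.exists_succ_eq.2 (Fin.ne_zero_of_lt hlt)
    obtain ⟨J', K', hc, hJ', hK'⟩ := exists_consecutive h0 hlast i
    have hK'' : K' = i.succ := le_antisymm
      (hc.right_le hK (hJ'.trans_lt Fin.castSucc_lt_succ)) hK'
    subst hK''
    have h1 := ih J' hc.1 hc.2.1 J hJ (hc.le_left hJ hlt)
    have h2 := hD _ (hmG _ hc.2.1) _ (hmG _ hK) (hm _ _ hc.2.1 hK hc.1).le
    rw [hfm _ hc.2.1, hfm _ hK, hgeo _ _ hc _ _ le_rfl hc.1.le le_rfl] at h2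
    linarith

/-- A function that takes the values `α J` at the points `m J` and whose variation is almost
that of the chain `α` runs through the chain monotonically. -/
theorem exists_monotone_index {V : Set E} {γ : ℝ} {D : ℝ → ℝ} (h0 : A 0) (hlast : A (Fin.last n))
    (hgeo : ∀ J K, Consecutive A J K → ∀ i j, J ≤ i → i ≤ j → j ≤ K →
      dist (α i) (α j) = Λ j - Λ i)
    (hinj : ∀ J K, Consecutive A J K → ∀ i j, J ≤ i → i < j → j ≤ K → α i ≠ α j)
    (hbetween : ∀ J K, Consecutive A J K → ∀ y ∈ V,
      dist (α J) y + dist y (α K) < dist (α J) (α K) + γ → ∃ k, J ≤ k ∧ k ≤ K ∧ y = α k)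
    (hsep : ∀ y ∈ V, ∀ y' ∈ V, y ≠ y' → γ ≤ dist y y') (hfV : ∀ z ∈ G, f z ∈ V)
    (hmG : ∀ J, A J → m J ∈ G) (hfm : ∀ J, A J → f (m J) = α J)
    (hm : ∀ J K, A J → A K → J < K → m J < m K)
    (hD : ∀ x ∈ G, ∀ y ∈ G, x ≤ y → dist (f x) (f y) ≤ D y - D x)
    (hDγ : ∀ x ∈ G, ∀ y ∈ G, x ≤ y → D y - D x < Λ (Fin.last n) - Λ 0 + γ) :
    ∃ κ : ℝ → Fin (n + 1), MonotoneOn κ G ∧ (∀ z ∈ G, f z = α (κ z)) ∧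
      ∀ z ∈ G, ∀ J, A J → (m J ≤ z → J ≤ κ z) ∧ (z ≤ m J → κ z ≤ J) := by
  have hmono : ∀ J K, A J → A K → J ≤ K → m J ≤ m K := fun J K hJ hK h =>
    h.eq_or_lt.elim (fun h => by rw [h]) fun h => (hm J K hJ hK h).le
  have hge := sub_le_cumulative_variation h0 hlast hgeo hmG hfm hm hD
  have hDnn : ∀ x ∈ G, ∀ y ∈ G, x ≤ y → D x ≤ D y := fun x hx y hy hxy =>
    sub_nonneg.1 (dist_nonneg.trans (hD x hx y hy hxy))
  -- The surplus is below `γ` on every stretch, because the variation outside it already reaches the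
  -- length of the chain there.
  have hlt : ∀ J K, A J → A K → J ≤ K → D (m K) - D (m J) < Λ K - Λ J + γ := by
    intro J K hJ hK hJK
    have h1 := hge J hJ 0 h0 (Fin.zero_le J)
    have h2 := hge (Fin.last n) hlast K hK (Fin.le_last K)
    have h3 := hDγ _ (hmG 0 h0) _ (hmG _ hlast) (hmono _ _ h0 hlast (Fin.zero_le _))
    linarith
  have htot := hge (Fin.last n) hlast 0 h0 (Fin.zero_le _)
  -- the position of a point relative to the points `m J`
  have hpos : ∀ z, z < m 0 ∨ (∃ J, A J ∧ z = m J) ∨ m (Fin.last n) < z ∨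
      ∃ J K, Consecutive A J K ∧ m J < z ∧ z < m K := by
    classical
    intro z
    by_cases hz0 : z < m 0
    · exact Or.inl hz0
    right
    obtain ⟨J, hJ, hJmax⟩ := Finset.exists_max_image
      (Finset.univ.filter fun q => A q ∧ m q ≤ z) id ⟨0, by simp [h0, not_lt.1 hz0]⟩
    simp only [Finset.mem_filter, Finset.mem_univ, true_and, id, and_imp] at hJ hJmax
    rcases hJ.2.eq_or_lt with heq | hlt
    · exact Or.inl ⟨J, hJ.1, heq.symm⟩
    right
    by_cases hJl : J = Fin.last n
    · exact Or.inl (hJl ▸ hlt)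
    right
    obtain ⟨i, rfl⟩ := Fin.exists_castSucc_eq.2 hJl
    obtain ⟨J', K', hc, hJ', hK'⟩ := exists_consecutive h0 hlast i
    have hJ'' : J' = i.castSucc := le_antisymm hJ'
      (hc.le_left hJ.1 (Fin.castSucc_lt_succ.trans_le hK'))
    subst hJ''
    exact ⟨_, _, hc, hlt, not_le.1 fun h => absurd (hJmax _ hc.2.2.1 h) (not_le.2 hc.1)⟩
  -- Before the first and after the last mark, a value other than the end value would cost an extra
  -- `γ`. Between consecutive marks the detour through `f z` exceeds the direct distance by less
  -- than `γ`, so `hbetween` applies.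
  have hex : ∀ z ∈ G, ∃ k, f z = α k ∧ ∀ J, A J → (m J ≤ z → J ≤ k) ∧ (z ≤ m J → k ≤ J) := by
    intro z hz
    rcases hpos z with h | ⟨J, hJ, rfl⟩ | h | ⟨J, K, hc, hJz, hzK⟩
    · refine ⟨0, ?_, fun J hJ => ⟨fun h' => ?_, fun _ => Fin.zero_le _⟩⟩
      · by_contra hne
        rw [← hfm 0 h0] at hne
        have h1 := hsep _ (hfV z hz) _ (hfV _ (hmG 0 h0)) hne
        have h2 := hD _ hz _ (hmG 0 h0) h.le
        have h3 := hDγ _ hz _ (hmG _ hlast) (h.le.trans (hmono _ _ h0 hlast (Fin.zero_le _)))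
        linarith
      · exact absurd ((hmono _ _ h0 hJ (Fin.zero_le _)).trans h') (not_le.2 h)
    · exact ⟨J, hfm J hJ, fun J' hJ' => ⟨fun h => not_lt.1 fun h' =>
        absurd (hm _ _ hJ hJ' h') (not_lt.2 h), fun h => not_lt.1 fun h' =>
        absurd (hm _ _ hJ' hJ h') (not_lt.2 h)⟩⟩
    · refine ⟨Fin.last n, ?_, fun J hJ => ⟨fun _ => Fin.le_last _, fun h' => ?_⟩⟩
      · by_contra hne
        rw [← hfm _ hlast] at hne
        have h1 := hsep _ (hfV z hz) _ (hfV _ (hmG _ hlast)) hne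
        have h2 := hD _ (hmG _ hlast) _ hz h.le
        rw [dist_comm] at h2
        have h3 := hDγ _ (hmG 0 h0) _ hz ((hmono _ _ h0 hlast (Fin.zero_le _)).trans h.le)
        linarith
      · exact absurd (h'.trans (hmono _ _ hJ hlast (Fin.le_last _))) (not_le.2 h)
    · have h1 := hD _ (hmG _ hc.2.1) _ hz hJz.le
      have h2 := hD _ hz _ (hmG _ hc.2.2.1) hzK.le
      rw [hfm _ hc.2.1] at h1
      rw [hfm _ hc.2.2.1] at h2
      have h3 := hlt _ _ hc.2.1 hc.2.2.1 hc.1.le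
      obtain ⟨k, hJk, hkK, hk⟩ := hbetween J K hc (f z) (hfV z hz) (by
        rw [hgeo _ _ hc _ _ le_rfl hc.1.le le_rfl]; linarith)
      refine ⟨k, hk, fun J' hJ' => ⟨fun h => (hc.le_left hJ' (not_le.1 fun h' => ?_)).trans hJk,
        fun h => hkK.trans (hc.right_le hJ' (not_le.1 fun h' => ?_))⟩⟩
      · exact absurd ((hmono _ _ hc.2.2.1 hJ' h').trans h) (not_le.2 hzK)
      · exact absurd (h.trans (hmono _ _ hJ' hc.2.1 h')) (not_le.2 hJz)
  choose! κ hκ hκm using hex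
  refine ⟨κ, fun z hz z' hz' hzz' => ?_, hκ, hκm⟩
  rcases hpos z with h | ⟨J, hJ, rfl⟩ | h | ⟨J, K, hc, hJz, hzK⟩
  · exact ((hκm z hz 0 h0).2 h.le).trans (Fin.zero_le _)
  · exact ((hκm _ hz J hJ).2 le_rfl).trans ((hκm z' hz' J hJ).1 hzz')
  · exact (Fin.le_last _).trans ((hκm z' hz' _ hlast).1 (h.le.trans hzz'))
  · rcases le_or_gt (m K) z' with h | h
    · exact ((hκm z hz K hc.2.2.1).2 hzK.le).trans ((hκm z' hz' K hc.2.2.1).1 h)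
    -- A step backwards between two consecutive marks would retrace part of the chain and add a jump
    -- of size at least `γ`, against `hlt`.
    by_contra! hlt'
    have hJk' := (hκm z' hz' J hc.2.1).1 (hJz.le.trans hzz')
    have hkK := (hκm z hz K hc.2.2.1).2 hzK.le
    have hJk := hJk'.trans hlt'.le
    have h1 := hD _ (hmG _ hc.2.1) _ hz hJz.le
    have h2 := hD _ hz' _ (hmG _ hc.2.2.1) h.le
    have h3 := hD _ hz _ hz' hzz'
    have h4 := hsep _ (hfV z' hz') _ (hfV z hz) (by
      rw [hκ z hz, hκ z' hz']; exact hinj _ _ hc _ _ hJk' hlt' hkK)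
    have h5 : (0 : ℝ) ≤ dist (α (κ z')) (α (κ z)) := dist_nonneg
    have h6 := hlt _ _ hc.2.1 hc.2.2.1 hc.1.le
    rw [dist_comm] at h3
    rw [hfm _ hc.2.1, hκ z hz, hgeo _ _ hc _ _ le_rfl hJk hkK] at h1
    rw [hfm _ hc.2.2.1, hκ z' hz', hgeo _ _ hc _ _ hJk' (hlt'.le.trans hkK) le_rfl] at h2
    rw [hgeo _ _ hc _ _ hJk' hlt'.le hkK] at h5
    linarith

end Chain

/-- The `J`-th interval between consecutive switching times is nondegenerate. -/
def IsActive (T : ℝ) (t : EuclideanSpace ℝ (Fin n)) (J : Fin (n + 1)) : Prop :=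
  knots T t J.castSucc < knots T t J.succ

/-- All intervals strictly between `J` and `K` are degenerate, so the knots from the right end of
`J` to the left end of `K` coincide. -/
theorem knots_eq_of_consecutive {t : EuclideanSpace ℝ (Fin n)} (ht : Monotone (knots T t))
    {J K : Fin (n + 1)} (hc : Consecutive (IsActive T t) J K) {i : Fin n} (hJ : J ≤ i.castSucc)
    (hK : i.succ ≤ K) : t i = knots T t J.succ ∧ t i = knots T t K.castSucc := by
  have hstep : ∀ q : Fin (n + 1), J < q → q < K → knots T t q.castSucc = knots T t q.succ :=
    fun q h1 h2 => le_antisymm (ht Fin.castSucc_lt_succ.le) (not_lt.1 (hc.2.2.2 q h1 h2))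
  have hall : ∀ r : ℕ, J.val + 1 ≤ r → ∀ hr : r < n + 1, r ≤ K.val →
      knots T t (Fin.castSucc ⟨r, hr⟩) = knots T t J.succ := by
    intro r hr
    induction r, hr using Nat.le_induction with
    | base => exact fun _ _ => rfl
    | succ r hr ih =>
      intro h1 h2
      rw [← ih (by omega) (by omega)]
      exact (hstep ⟨r, by omega⟩ (Fin.lt_def.2 hr) (Fin.lt_def.2 h2)).symm
  rw [← knots_succ_castSucc (T := T)]
  have h1 := hall i.succ.val (by simpa [Fin.le_def] using hJ) i.succ.isLt hK
  have h2 := hall K.val (Fin.lt_def.1 hc.1) K.isLt le_rfl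
  exact ⟨h1, h1.trans h2.symm⟩

/-- The values in a block of coinciding switching times, including both ends, subdivide a
segment. -/
structure Subdivides (V : Finset (Fin M → ℤ)) (a : Fin (n + 1) → Fin M → ℝ) (J K : Fin (n + 1))
    (l : Fin (n + 1) → ℝ) : Prop where
  ne : a J ≠ a K
  strictMono : StrictMonoOn l (Icc J K)
  eq : ∀ k ∈ Icc J K, a k = (1 - l k) • a J + l k • a K
  surj : ∀ c ∈ Icc (0 : ℝ) 1, (1 - c) • a J + c • a K ∈ controlValues V → ∃ k ∈ Icc J K, l k = c

namespace IsFullRepresentation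

variable {V : Finset (Fin M → ℤ)} {u : L1 M T} {a : Fin (n + 1) → Fin M → ℝ}
  {t : EuclideanSpace ℝ (Fin n)}

theorem isActive_zero (h : IsFullRepresentation V u a t) (hT : 0 < T) : IsActive T t 0 := by
  unfold IsActive
  rcases n with _ | n
  · exact (by rw [knots_last]; exact hT : knots T t 0 < knots T t (Fin.last 1))
  · have := (h.interior 0).1
    rwa [← knots_castSucc_succ (T := T)] at this

theorem isActive_last (h : IsFullRepresentation V u a t) (hT : 0 < T) :
    IsActive T t (Fin.last n) := by
  unfold IsActive
  rw [Fin.succ_last, knots_last]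
  rcases n with _ | n
  · exact (by simpa using hT : knots T t 0 < T)
  · have := (h.interior (Fin.last n)).2
    rwa [← knots_succ_castSucc (T := T)] at this

theorem exists_subdivides (h : IsFullRepresentation V u a t) {J K : Fin (n + 1)}
    (hc : Consecutive (IsActive T t) J K) : ∃ l, Subdivides V a J K l := by
  obtain ⟨i, rfl⟩ := Fin.exists_castSucc_eq.2 (Fin.ne_last_of_lt hc.1)
  obtain ⟨j, rfl⟩ := Fin.exists_succ_eq.2 (Fin.ne_zero_of_lt hc.1)
  have hij : i ≤ j := Fin.castSucc_lt_succ_iff.1 hc.1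
  have hi := (knots_eq_of_consecutive h.monotone hc le_rfl (Fin.succ_le_succ_iff.2 hij)).1
  have hj := (knots_eq_of_consecutive h.monotone hc (Fin.castSucc_le_castSucc_iff.2 hij) le_rfl)
  obtain ⟨l, hl, hla, hlV⟩ := h.convex i j hij (by rw [hi]; exact hc.2.1) (hi.trans hj.1.symm)
    (by rw [hj.2]; exact hc.2.2.1)
  have hmem : ∀ k, k ∈ Ioc i.castSucc j.castSucc ↔ k ≠ i.castSucc ∧ k ≠ j.succ ∧
      k ∈ Icc i.castSucc j.succ := fun k => by
    simp only [mem_Ioc, mem_Icc, ne_eq, Fin.le_def, Fin.lt_def, Fin.ext_iff, Fin.val_castSucc,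
      Fin.val_succ]
    omega
  have hne : i.castSucc ≠ j.succ := hc.1.ne
  -- The given parameters cover only the intermediate values; the two ends receive 0 and 1.
  refine ⟨fun k => if k = i.castSucc then 0 else if k = j.succ then 1 else l k, ?_, ?_, ?_, ?_⟩
  · intro heq
    -- If the end values agreed, every `c` in `(0,1)` would give a point of `V` and need its own
    -- index, but there are finitely many indices.
    have hsub : Ioo (0 : ℝ) 1 ⊆ l '' univ := fun c hc' => by
      obtain ⟨k, _, hk⟩ := hlV c hc' (by
        rw [← heq, ← add_smul, sub_add_cancel, one_smul]; exact h.values_mem _)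
      exact ⟨k, mem_univ k, hk⟩
    exact (Ioo_infinite zero_lt_one) ((toFinite univ).image l |>.subset hsub)
  · intro k hk k' hk' hkk'
    have hk0 : k ≠ j.succ := (hkk'.trans_le hk'.2).ne
    have hk1 : k' ≠ i.castSucc := (hk.1.trans_lt hkk').ne'
    simp only [hk0, hk1, if_false]
    by_cases h1 : k = i.castSucc <;> by_cases h2 : k' = j.succ
    · simp [h1, h2]
    · simpa [h1, h2] using (hla k' ((hmem k').2 ⟨hk1, h2, hk'⟩)).1.1
    · simpa [h1, h2] using (hla k ((hmem k).2 ⟨h1, hk0, hk⟩)).1.2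
    · simpa [h1, h2] using hl ((hmem k).2 ⟨h1, hk0, hk⟩) ((hmem k').2 ⟨hk1, h2, hk'⟩) hkk'
  · intro k hk
    by_cases h1 : k = i.castSucc
    · simp [h1]
    by_cases h2 : k = j.succ
    · simp [h2, hne.symm]
    · simpa [h1, h2] using (hla k ((hmem k).2 ⟨h1, h2, hk⟩)).2
  · intro c hc01 hcV
    by_cases h0 : c = 0
    · exact ⟨i.castSucc, ⟨le_rfl, hc.1.le⟩, by simp [h0]⟩
    by_cases h1 : c = 1
    · exact ⟨j.succ, ⟨hc.1.le, le_rfl⟩, by simp [h1, hne.symm]⟩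
    obtain ⟨k, hk, hkc⟩ := hlV c ⟨lt_of_le_of_ne hc01.1 (Ne.symm h0), lt_of_le_of_ne hc01.2 h1⟩ hcV
    obtain ⟨hk1, hk2, hk3⟩ := (hmem k).1 hk
    exact ⟨k, hk3, by simp [hk1, hk2, hkc]⟩

end IsFullRepresentation

namespace Subdivides

variable {V : Finset (Fin M → ℤ)} {a : Fin (n + 1) → Fin M → ℝ} {J K : Fin (n + 1)}
  {l : Fin (n + 1) → ℝ}

theorem sub_eq (h : Subdivides V a J K l) {i j : Fin (n + 1)} (hi : i ∈ Icc J K)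
    (hj : j ∈ Icc J K) : a j - a i = (l j - l i) • (a K - a J) := by
  rw [h.eq i hi, h.eq j hj]
  module

theorem injOn (h : Subdivides V a J K l) {i j : Fin (n + 1)} (hi : i ∈ Icc J K)
    (hj : j ∈ Icc J K) (hij : i < j) : a i ≠ a j := fun heq => by
  have h1 := h.sub_eq hi hj
  rw [← heq, sub_self, eq_comm, smul_eq_zero] at h1
  exact h1.elim (fun h2 => (sub_pos.2 (h.strictMono hi hj hij)).ne' h2)
    fun h2 => h.ne (sub_eq_zero.1 h2).symm

theorem vecNorm_sub {p : ℝ≥0∞} [Fact (1 ≤ p)] (h : Subdivides V a J K l) {i j : Fin (n + 1)}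
    (hi : i ∈ Icc J K) (hj : j ∈ Icc J K) (hij : i ≤ j) :
    vecNorm p (a j - a i) = (l j - l i) * vecNorm p (a K - a J) := by
  have h0 : 0 ≤ l j - l i := sub_nonneg.2 (h.strictMono.monotoneOn hi hj hij)
  rw [h.sub_eq hi hj, vecNorm, WithLp.toLp_smul, norm_smul, Real.norm_of_nonneg h0]
  rfl

/-- Along a segment traversed in order, norms of differences add up. -/
theorem vecNorm_sub_eq_arcLength {p : ℝ≥0∞} [Fact (1 ≤ p)] (h : Subdivides V a J K l)
    {i j : Fin (n + 1)} (hi : J ≤ i) (hij : i ≤ j) (hj : j ≤ K) :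
    vecNorm p (a j - a i) = arcLength p a j - arcLength p a i := by
  induction j using Fin.induction with
  | zero => simp [Fin.le_zero_iff.1 hij, vecNorm]
  | succ j ih =>
    rcases hij.eq_or_lt with rfl | hlt
    · simp [vecNorm]
    have hij' : i ≤ j.castSucc := Fin.le_castSucc_iff.2 hlt
    have hjK : j.castSucc ≤ K := Fin.castSucc_lt_succ.le.trans hj
    have h1 := ih hij' hjK
    have hi' : i ∈ Icc J K := ⟨hi, hij'.trans hjK⟩
    have hj' : j.castSucc ∈ Icc J K := ⟨hi.trans hij', hjK⟩
    have hj'' : j.succ ∈ Icc J K := ⟨hi.trans hij, hj⟩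
    rw [arcLength_succ, h.vecNorm_sub hj' hj'' Fin.castSucc_lt_succ.le, add_sub_right_comm, ← h1,
      h.vecNorm_sub hi' hj' hij', h.vecNorm_sub hi' hj'' hij]
    ring

/-- By strict convexity, equality in the triangle inequality places `y` on the segment, and the
block lists every point of `V` there. -/
theorem exists_eq_of_dist_add_dist {p : ℝ≥0∞} [Fact (1 ≤ p)] (hp : 1 < p) (hp' : p < ⊤)
    (h : Subdivides V a J K l) {y : Fin M → ℝ} (hy : y ∈ controlValues V)
    (hdist : dist (WithLp.toLp p (a J)) (WithLp.toLp p y)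
      + dist (WithLp.toLp p y) (WithLp.toLp p (a K))
        = dist (WithLp.toLp p (a J)) (WithLp.toLp p (a K))) :
    ∃ k, J ≤ k ∧ k ≤ K ∧ y = a k := by
  have := strictConvexSpace_piLp (M := M) hp hp'
  obtain ⟨c, hc, hcy⟩ := dist_add_dist_eq_iff.1 hdist
  have hy' : y = (1 - c) • a J + c • a K := by
    have := congrArg WithLp.ofLp hcy
    rw [AffineMap.lineMap_apply_module] at this
    exact this.symm
  obtain ⟨k, hk, rfl⟩ := h.surj c hc (hy' ▸ hy)
  exact ⟨k, hk.1, hk.2, hy'.trans (h.eq k hk).symm⟩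

end Subdivides

end Chains

/-! ### Structure of the feasible controls close to `u` -/

section Structure

variable {M n : ℕ} {T : ℝ}

theorem exists_pos_le_of_finite {S : Set ℝ} (hS : S.Finite) :
    ∃ γ : ℝ, 0 < γ ∧ ∀ x ∈ S, 0 < x → γ ≤ x := by
  rcases (S ∩ Ioi 0).eq_empty_or_nonempty with h | h
  · exact ⟨1, one_pos, fun x hx hx0 => absurd (show x ∈ S ∩ Ioi 0 from ⟨hx, hx0⟩) (h ▸ by simp)⟩
  · obtain ⟨γ, hγ, hmin⟩ := exists_min_image _ id (hS.subset inter_subset_left) h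
    exact ⟨γ, hγ.2, fun x hx hx0 => hmin x ⟨hx, hx0⟩⟩

theorem finite_controlValues (V : Finset (Fin M → ℤ)) : (controlValues V).Finite :=
  V.finite_toSet.image _

theorem one_le_norm_sub {V : Finset (Fin M → ℤ)} {y y' : Fin M → ℝ} (hy : y ∈ controlValues V)
    (hy' : y' ∈ controlValues V) (hne : y ≠ y') :
    1 ≤ ‖(WithLp.toLp 1 y - WithLp.toLp 1 y' : PiLp 1 fun _ : Fin M => ℝ)‖ := by
  obtain ⟨ν, -, rfl⟩ := hy
  obtain ⟨ν', -, rfl⟩ := hy'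
  obtain ⟨i, hi⟩ : ∃ i, ν i ≠ ν' i := by
    by_contra! h
    exact hne (by simp only [h])
  refine le_trans ?_ (PiLp.norm_apply_le _ i)
  have h1 : 1 ≤ |ν i - ν' i| := Int.one_le_abs (sub_ne_zero.2 hi)
  have h2 : (1 : ℝ) ≤ |(ν i : ℝ) - ν' i| := by exact_mod_cast h1
  simpa using h2

/-- Finitely many points give finitely many distances and triangle excesses, so the positive ones
have a positive minimum. -/
theorem exists_gap (p : ℝ≥0∞) [Fact (1 ≤ p)] (V : Finset (Fin M → ℤ)) :
    ∃ γ : ℝ, 0 < γ ∧ ∀ y ∈ WithLp.toLp p '' controlValues V,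
      ∀ y' ∈ WithLp.toLp p '' controlValues V, (y ≠ y' → γ ≤ dist y y') ∧
        ∀ z ∈ WithLp.toLp p '' controlValues V, dist y y' + dist y' z < dist y z + γ →
          dist y y' + dist y' z = dist y z := by
  set W : Set (PiLp p fun _ : Fin M => ℝ) := WithLp.toLp p '' controlValues V
  have hW : W.Finite := (finite_controlValues V).image _
  obtain ⟨γ₁, h1, hγ₁⟩ := exists_pos_le_of_finite
    ((hW.prod hW).image fun q : (PiLp p fun _ : Fin M => ℝ) × (PiLp p fun _ : Fin M => ℝ) =>
      dist q.1 q.2)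
  obtain ⟨γ₂, h2, hγ₂⟩ := exists_pos_le_of_finite
    ((hW.prod (hW.prod hW)).image fun q : (PiLp p fun _ : Fin M => ℝ) ×
      (PiLp p fun _ : Fin M => ℝ) × (PiLp p fun _ : Fin M => ℝ) =>
      dist q.1 q.2.1 + dist q.2.1 q.2.2 - dist q.1 q.2.2)
  refine ⟨min γ₁ γ₂, lt_min h1 h2, fun y hy y' hy' => ⟨fun hne => ?_, fun z hz hlt => ?_⟩⟩
  · exact (min_le_left _ _).trans (hγ₁ _ ⟨(y, y'), ⟨hy, hy'⟩, rfl⟩ (dist_pos.2 hne))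
  · by_contra hne
    have hpos : 0 < dist y y' + dist y' z - dist y z :=
      sub_pos.2 (lt_of_le_of_ne (dist_triangle _ _ _) (Ne.symm hne))
    have := (min_le_right γ₁ γ₂).trans (hγ₂ _ ⟨(y, y', z), ⟨hy, hy', hz⟩, rfl⟩ hpos)
    linarith

theorem exists_le_active_length (t : EuclideanSpace ℝ (Fin n)) :
    ∃ ρ : ℝ, 0 < ρ ∧ ∀ J, IsActive T t J → ρ ≤ knots T t J.succ - knots T t J.castSucc := by
  obtain ⟨ρ, hρ, h⟩ := exists_pos_le_of_finite
    (finite_range fun J : Fin (n + 1) => knots T t J.succ - knots T t J.castSucc)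
  exact ⟨ρ, hρ, fun J hJ => h _ ⟨J, rfl⟩ (sub_pos.2 hJ)⟩

theorem ae_stepControl_eq {t : EuclideanSpace ℝ (Fin n)} (ht : Monotone (knots T t))
    (a : Fin (n + 1) → Fin M → ℝ) :
    ∀ᵐ z ∂volume.restrict (Ioo 0 T), ∀ q, z ∈ knotInterval T t q →
      stepControl T t a z = WithLp.toLp 1 (a q) := by
  filter_upwards [coeFn_stepControl t a] with z hz q hq
  rw [hz, stepFun_eq_of_mem ht a hq]

theorem Ioo_knots_subset {t : EuclideanSpace ℝ (Fin n)} (ht : Monotone (knots T t))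
    (j k : Fin (n + 2)) : Ioo (knots T t j) (knots T t k) ⊆ Ioo 0 T :=
  Ioo_subset_Ioo (by simpa using ht (Fin.zero_le j)) (by simpa using ht (Fin.le_last k))

theorem stepControl_mem_feasibleControls {V : Finset (Fin M → ℤ)} {s : EuclideanSpace ℝ (Fin n)}
    (hs : Monotone (knots T s)) {a : Fin (n + 1) → Fin M → ℝ} (ha : ∀ k, a k ∈ controlValues V) :
    stepControl T s a ∈ feasibleControls T V := by
  filter_upwards [ae_stepControl_eq hs a, ae_restrict_mem measurableSet_Ioo] with z hz hzT
  obtain ⟨q, hq⟩ := exists_mem_knotInterval s hzT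
  rw [hz q hq]
  exact ha q

namespace IsFullRepresentation

variable {V : Finset (Fin M → ℤ)} {u : L1 M T} {a : Fin (n + 1) → Fin M → ℝ}
  {t : EuclideanSpace ℝ (Fin n)}

/-- The switching times are controlled by the `L¹`-distance of the step functions, if they do not
move past the marks `m J` in the intervals between distinct switching times. -/
theorem abs_sub_le_norm_sub (h : IsFullRepresentation V u a t) (hT : 0 < T)
    {s : EuclideanSpace ℝ (Fin n)} (hs : Monotone (knots T s)) {m : Fin (n + 1) → ℝ}
    (hm : ∀ J, IsActive T t J → m J ∈ Ioo (knots T t J.castSucc) (knots T t J.succ))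
    (hsm : ∀ J, IsActive T t J → m J ∈ Icc (knots T s J.castSucc) (knots T s J.succ))
    (k : Fin n) : |s k - t k| ≤ ‖stepControl T s a - stepControl T t a‖ := by
  obtain ⟨J, K, hc, hJk, hkK⟩ := exists_consecutive (h.isActive_zero hT) (h.isActive_last hT) k
  obtain ⟨l, hl⟩ := h.exists_subdivides hc
  obtain ⟨htJ, htK⟩ := knots_eq_of_consecutive h.monotone hc hJk hkK
  have hmJ := hm J hc.2.1
  have hmK := hm K hc.2.2.1
  have hsmJ := hsm J hc.2.1
  have hsmK := hsm K hc.2.2.1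
  rw [← htJ] at hmJ
  rw [← htK] at hmK
  have hJs : m J ≤ s k := by
    rw [← knots_castSucc_succ (T := T) s k]
    exact hsmJ.2.trans (hs (Fin.succ_le_succ_iff.2 hJk))
  have hKs : s k ≤ m K := by
    rw [← knots_succ_castSucc (T := T) s k]
    exact (hs (Fin.castSucc_le_castSucc_iff.2 hkK)).trans hsmK.1
  have hsI := mem_Icc_of_monotone_knots hs k
  have htI := mem_Icc_of_monotone_knots h.monotone k
  rcases le_total (t k) (s k) with hle | hle
  · rw [abs_of_nonneg (sub_nonneg.2 hle)]
    refine sub_le_norm_sub (Ioo_subset_Ioo htI.1 hsI.2) ?_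
    filter_upwards [ae_stepControl_eq hs a, ae_stepControl_eq h.monotone a,
      ae_restrict_mem measurableSet_Ioo] with z hzs hzt hzT hz
    obtain ⟨q, hq⟩ := exists_mem_knotInterval s hzT
    rw [hzs q hq, hzt K (Ioo_subset_knotInterval t K
      ⟨htK ▸ hz.1, (hz.2.trans_le hKs).trans hmK.2⟩)]
    have hq' := knotInterval_subset_Ico s q hq
    refine one_le_norm_sub (h.values_mem q) (h.values_mem K) ?_
    -- Here `z` lies before `s k` and after the mark `m J`, so the index satisfies `J ≤ q < K`.
    -- Values within a block are distinct, so `a q` differs from the value `a K` for `t`.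
    have hqk : q ≤ k.castSucc := by
      rw [Fin.le_castSucc_iff]
      by_contra! hlt
      have := hs (Fin.castSucc_le_castSucc_iff.2 hlt)
      rw [knots_succ_castSucc] at this
      linarith [hq'.1, hz.2]
    have hJq : J ≤ q := by
      by_contra! hlt
      have := hs (Fin.succ_le_castSucc_iff.2 hlt)
      linarith [hq'.2, hz.1, hsmJ.1, hmJ.2]
    have hqK : q < K := (hqk.trans_lt Fin.castSucc_lt_succ).trans_le hkK
    exact hl.injOn ⟨hJq, hqK.le⟩ ⟨hc.1.le, le_rfl⟩ hqK
  · rw [abs_sub_comm, abs_of_nonneg (sub_nonneg.2 hle)]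
    refine sub_le_norm_sub (Ioo_subset_Ioo hsI.1 htI.2) ?_
    filter_upwards [ae_stepControl_eq hs a, ae_stepControl_eq h.monotone a,
      ae_restrict_mem measurableSet_Ioo] with z hzs hzt hzT hz
    obtain ⟨q, hq⟩ := exists_mem_knotInterval s hzT
    rw [hzs q hq, hzt J (Ioo_subset_knotInterval t J
      ⟨(hmJ.1.trans_le hJs).trans hz.1, htJ ▸ hz.2⟩)]
    have hq' := knotInterval_subset_Ico s q hq
    refine one_le_norm_sub (h.values_mem q) (h.values_mem J) ?_
    have hkq : k.succ ≤ q := by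
      rw [← Fin.castSucc_lt_iff_succ_le]
      by_contra! hlt
      have := hs (Fin.succ_le_succ_iff.2 hlt)
      rw [knots_castSucc_succ] at this
      linarith [hq'.2, hz.1]
    have hqK : q ≤ K := by
      by_contra! hlt
      have := hs (Fin.succ_le_castSucc_iff.2 hlt)
      linarith [hq'.1, hz.2, hsmK.2, hmK.1]
    have hJq : J < q := (hJk.trans_lt Fin.castSucc_lt_succ).trans_le hkq
    exact (hl.injOn ⟨le_rfl, hc.1.le⟩ ⟨hJq.le, hqK⟩ hJq).symm

/-- A feasible control close to `u` attains the value `a J` in the `J`-th interval. -/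
theorem exists_mem_eq (h : IsFullRepresentation V u a t) {w : L1 M T}
    (hw : w ∈ feasibleControls T V) {G : Set ℝ} (hG : ∀ᵐ z ∂volume.restrict (Ioo 0 T), z ∈ G)
    {J : Fin (n + 1)} (hwu : ‖w - u‖ < knots T t J.succ - knots T t J.castSucc) :
    ∃ z ∈ Ioo (knots T t J.castSucc) (knots T t J.succ), z ∈ G ∧ w z = WithLp.toLp 1 (a J) := by
  by_contra! hcon
  refine absurd (sub_le_norm_sub (Ioo_knots_subset h.monotone J.castSucc J.succ) ?_)
    (not_le.2 hwu)
  filter_upwards [hw, hG, h.eq_stepControl ▸ ae_stepControl_eq h.monotone a] with z hz hzG hzu hzJ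
  rw [hzu J (Ioo_subset_knotInterval t J hzJ)]
  exact one_le_norm_sub hz (h.values_mem J) fun heq => hcon z hzJ hzG (congrArg (WithLp.toLp 1) heq)

/-- The `i`-th switching time is the supremum of the points with index at most `i`. The last
conclusion locates the marks relative to the new knots. -/
theorem exists_stepControl_eq_of_monotoneOn {w : L1 M T} (hT : 0 < T) {G : Set ℝ}
    (hGT : G ⊆ Ioo 0 T) (hG : ∀ᵐ z ∂volume.restrict (Ioo 0 T), z ∈ G) {κ : ℝ → Fin (n + 1)}
    (hκ : MonotoneOn κ G) (hwκ : ∀ z ∈ G, w z = WithLp.toLp 1 (a (κ z))) :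
    ∃ s ∈ feasibleTimes n T, w = stepControl T s a ∧ ∀ z ∈ G,
      z ∈ Icc (knots T s (κ z).castSucc) (knots T s (κ z).succ) := by
  -- Inserting 0 keeps the set nonempty, so that `s i = 0` when the indices up to `i` do not occur.
  set S : Fin n → Set ℝ := fun i => insert 0 {z | z ∈ G ∧ κ z ≤ i.castSucc} with hS
  have hST : ∀ i, ∀ z ∈ S i, z ≤ T := by
    rintro i z (rfl | hz)
    · exact hT.le
    · exact (hGT hz.1).2.le
  have hbdd : ∀ i, BddAbove (S i) := fun i => ⟨T, hST i⟩
  set s : EuclideanSpace ℝ (Fin n) := WithLp.toLp 2 fun i => sSup (S i) with hs_def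
  have hs : ∀ i, s i = sSup (S i) := fun i => rfl
  have hs0 : ∀ i, 0 ≤ s i := fun i => le_csSup (hbdd i) (mem_insert _ _)
  have hsT : ∀ i, s i ≤ T := fun i => csSup_le (insert_nonempty _ _) (hST i)
  have hmono : Monotone (knots T s) :=
    monotone_knots hT.le (fun i => ⟨hs0 i, hsT i⟩) fun i j hij =>
      csSup_le_csSup (hbdd j) (insert_nonempty _ _)
        (insert_subset_insert fun z hz => ⟨hz.1, hz.2.trans (Fin.castSucc_le_castSucc_iff.2 hij)⟩)
  have hlow : ∀ z ∈ G, ∀ i : Fin n, κ z ≤ i.castSucc → z ≤ s i := fun z hz i hi =>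
    le_csSup (hbdd i) (mem_insert_of_mem _ ⟨hz, hi⟩)
  have hup : ∀ z ∈ G, ∀ i : Fin n, i.succ ≤ κ z → s i ≤ z := fun z hz i hi =>
    csSup_le (insert_nonempty _ _) (by
      rintro r (rfl | hr)
      · exact (hGT hz).1.le
      · by_contra! hlt
        exact absurd (hκ hz hr.1 hlt.le)
          (not_le.2 ((hr.2.trans_lt Fin.castSucc_lt_succ).trans_le hi)))
  have hIcc : ∀ z ∈ G, z ∈ Icc (knots T s (κ z).castSucc) (knots T s (κ z).succ) := by
    intro z hz
    constructor
    · rcases Fin.eq_zero_or_eq_succ (κ z) with h0 | ⟨i, hi⟩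
      · rw [h0, Fin.castSucc_zero, knots_zero]
        exact (hGT hz).1.le
      · rw [hi, knots_succ_castSucc]
        exact hup z hz i hi.ge
    · rcases Fin.eq_castSucc_or_eq_last (κ z) with ⟨i, hi⟩ | h0
      · rw [hi, knots_castSucc_succ]
        exact hlow z hz i hi.le
      · rw [h0, Fin.succ_last, knots_last]
        exact (hGT hz).2.le
  refine ⟨s, hmono, Lp.ext ?_, hIcc⟩
  -- Away from the finitely many knots, the closed intervals of `hIcc` may be replaced by open ones.
  have hnull : ∀ᵐ z ∂volume.restrict (Ioo 0 T), z ∉ range fun j => knots T s j :=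
    ae_restrict_of_ae (measure_eq_zero_iff_ae_notMem.1 ((finite_range _).measure_zero volume))
  filter_upwards [hG, ae_stepControl_eq hmono a, hnull] with z hz hzs hzn
  rw [hwκ z hz, hzs (κ z) (Ioo_subset_knotInterval s _ ⟨?_, ?_⟩)]
  · exact lt_of_le_of_ne (hIcc z hz).1 fun h => hzn ⟨_, h⟩
  · exact lt_of_le_of_ne (hIcc z hz).2 fun h => hzn ⟨_, h.symm⟩

/-- A feasible control close to `u` has at least the total variation of `u`; if it has not much
more, then it arises from `u` by moving the switching times. -/
theorem exists_stepControl_eq (h : IsFullRepresentation V u a t) (hT : 0 < T) {p : ℝ≥0∞}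
    (hp : 1 < p) (hp' : p < ⊤) :
    ∃ ρ : ℝ, 0 < ρ ∧ ∃ γ : ℝ, 0 < γ ∧ ∀ w ∈ feasibleControls T V, ‖w - u‖ < ρ →
      (arcLength p a (Fin.last n) : EReal) ≤ TV p w ∧
      (TV p w < ((arcLength p a (Fin.last n) + γ : ℝ) : EReal) →
        ∃ s ∈ feasibleTimes n T, w = stepControl T s a ∧ ∀ k, |s k - t k| ≤ ‖w - u‖) := by
  have : Fact (1 ≤ p) := ⟨hp.le⟩
  obtain ⟨ρ, hρ, hlen⟩ := exists_le_active_length (T := T) t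
  obtain ⟨γ, hγ, hgap⟩ := exists_gap p V
  refine ⟨ρ, hρ, γ, hγ, fun w hw hwu => ?_⟩
  rcases eq_or_ne (TV p w) ⊤ with htop | htop
  · rw [htop]
    exact ⟨le_top, fun hlt => absurd hlt not_top_lt⟩
  have hbot : TV p w ≠ ⊥ := ((EReal.bot_lt_zero).trans_le (TV_nonneg p w)).ne'
  lift TV p w to ℝ using ⟨htop, hbot⟩ with C hC
  rw [EReal.coe_le_coe_iff, EReal.coe_lt_coe_iff]
  obtain ⟨G₀, hG₀T, hG₀, D, hD⟩ := exists_cumulative_variation hp hp' w hC.ge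
  set G : Set ℝ := {z | z ∈ G₀ ∧ (fun i => w z i) ∈ controlValues V} with hGdef
  have hGT : G ⊆ Ioo 0 T := fun z hz => hG₀T hz.1
  have hG : ∀ᵐ z ∂volume.restrict (Ioo 0 T), z ∈ G := by
    filter_upwards [hG₀, hw] with z h1 h2 using ⟨h1, h2⟩
  set f : ℝ → PiLp p fun _ : Fin M => ℝ := fun z => WithLp.toLp p fun i => w z i with hf
  set α : Fin (n + 1) → PiLp p fun _ : Fin M => ℝ := fun k => WithLp.toLp p (a k) with hα
  have hαinj : ∀ i j, α i = α j → a i = a j := fun i j hij => congrArg WithLp.ofLp hij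
  choose! m hmI hmG hm using fun J (hJ : IsActive T t J) =>
    h.exists_mem_eq hw hG (hwu.trans_le (hlen J hJ))
  have hmlt : ∀ J K, IsActive T t J → IsActive T t K → J < K → m J < m K := fun J K hJ hK hJK =>
    ((hmI J hJ).2.trans_le (h.monotone (Fin.succ_le_castSucc_iff.2 hJK))).trans (hmI K hK).1
  have hfm : ∀ J, IsActive T t J → f (m J) = α J := fun J hJ => by
    simp only [hf, hα, hm J hJ]
  have hgeo : ∀ J K, Consecutive (IsActive T t) J K → ∀ i j, J ≤ i → i ≤ j → j ≤ K →
      dist (α i) (α j) = arcLength p a j - arcLength p a i := fun J K hc i j hi hij hj => by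
    obtain ⟨l, hl⟩ := h.exists_subdivides hc
    rw [← hl.vecNorm_sub_eq_arcLength hi hij hj, dist_comm, dist_eq_norm]
    rfl
  have hDG : ∀ x ∈ G, ∀ y ∈ G, x ≤ y → dist (f x) (f y) ≤ D y - D x := fun x hx y hy hxy => by
    rw [dist_eq_norm]
    exact (hD x hx.1 y hy.1 hxy).1
  have h0 := h.isActive_zero hT
  have hlast := h.isActive_last hT
  have h0last : m 0 ≤ m (Fin.last n) := (Fin.zero_le (Fin.last n)).eq_or_lt.elim
    (fun h => by rw [← h]) fun h => (hmlt _ _ h0 hlast h).le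
  constructor
  · have h1 := sub_le_cumulative_variation h0 hlast hgeo hmG hfm hmlt hDG _ hlast _ h0
      (Fin.zero_le _)
    rw [arcLength_zero, sub_zero] at h1
    exact h1.trans (hD _ (hmG _ h0).1 _ (hmG _ hlast).1 h0last).2
  intro hlt
  obtain ⟨κ, hκ, hfκ, hκm⟩ := exists_monotone_index (V := WithLp.toLp p '' controlValues V)
    (γ := γ) h0 hlast hgeo (fun J K hc i j hi hij hj heq => by
      obtain ⟨l, hl⟩ := h.exists_subdivides hc
      exact hl.injOn ⟨hi, hij.le.trans hj⟩ ⟨hi.trans hij.le, hj⟩ hij (hαinj _ _ heq))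
    (by
      rintro J K hc _ ⟨y, hy, rfl⟩ hdist
      obtain ⟨l, hl⟩ := h.exists_subdivides hc
      have heq := (hgap _ ⟨_, h.values_mem J, rfl⟩ _ ⟨y, hy, rfl⟩).2 _
        ⟨_, h.values_mem K, rfl⟩ hdist
      obtain ⟨k, hJk, hkK, rfl⟩ := hl.exists_eq_of_dist_add_dist hp hp' hy heq
      exact ⟨k, hJk, hkK, rfl⟩)
    (fun y hy y' hy' => (hgap y hy y' hy').1) (fun z hz => ⟨_, hz.2, rfl⟩) hmG hfm hmlt hDG
    (fun x hx y hy hxy => by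
      rw [arcLength_zero, sub_zero]
      exact (hD x hx.1 y hy.1 hxy).2.trans_lt hlt)
  obtain ⟨s, hs, hws, hsκ⟩ := exists_stepControl_eq_of_monotoneOn (w := w) (a := a) hT hGT hG hκ
    fun z hz => PiLp.ext fun i => congrFun (congrArg WithLp.ofLp (hfκ z hz)) i
  -- Each mark keeps its index, hence lies in the interval of `s` with the same number, as the
  -- distance estimate requires.
  have hκJ : ∀ J, IsActive T t J → κ (m J) = J := fun J hJ =>
    le_antisymm ((hκm _ (hmG J hJ) J hJ).2 le_rfl) ((hκm _ (hmG J hJ) J hJ).1 le_rfl)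
  refine ⟨s, hs, hws, fun k => ?_⟩
  rw [h.eq_stepControl, hws]
  refine h.abs_sub_le_norm_sub hT hs hmI (fun J hJ => ?_) k
  have := hsκ _ (hmG J hJ)
  rwa [hκJ J hJ] at this

end IsFullRepresentation

end Structure

/-! ### Comparison of the two optimization problems -/

section Equivalence

variable {M n : ℕ} {T : ℝ}

theorem objective_le {F : L1 M T → ℝ} {β : ℝ} (hβ : 0 ≤ β) {p : ℝ≥0∞} {w : L1 M T} {c : ℝ}
    (h : TV p w ≤ c) : objective F β p w ≤ ((F w + β * c : ℝ) : EReal) := by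
  rw [EReal.coe_add, EReal.coe_mul]
  exact add_le_add le_rfl (mul_le_mul_of_nonneg_left h (EReal.coe_nonneg.2 hβ))

theorem le_objective {F : L1 M T → ℝ} {β : ℝ} (hβ : 0 ≤ β) {p : ℝ≥0∞} {w : L1 M T} {c : ℝ}
    (h : (c : EReal) ≤ TV p w) : ((F w + β * c : ℝ) : EReal) ≤ objective F β p w := by
  rw [EReal.coe_add, EReal.coe_mul]
  exact add_le_add le_rfl (mul_le_mul_of_nonneg_left h (EReal.coe_nonneg.2 hβ))

theorem norm_le_of_forall_abs_le {x : EuclideanSpace ℝ (Fin n)} {δ : ℝ} (hδ : 0 ≤ δ)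
    (h : ∀ k, |x k| ≤ δ) : ‖x‖ ≤ (n + 1) * δ := by
  rw [EuclideanSpace.norm_eq, Real.sqrt_le_iff]
  refine ⟨by positivity, ?_⟩
  have h1 : ∑ k, ‖x k‖ ^ 2 ≤ ∑ _k : Fin n, δ ^ 2 :=
    Finset.sum_le_sum fun k _ => pow_le_pow_left₀ (norm_nonneg _) (h k) 2
  rw [Finset.sum_const, Finset.card_univ, Fintype.card_fin, nsmul_eq_mul] at h1
  have hn : (n : ℝ) ≤ (n + 1) ^ 2 := by
    have : (0 : ℝ) ≤ n := Nat.cast_nonneg n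
    nlinarith
  rw [mul_pow]
  exact h1.trans (mul_le_mul_of_nonneg_right hn (sq_nonneg δ))

theorem abs_sub_le_norm (s t : EuclideanSpace ℝ (Fin n)) (k : Fin n) : |s k - t k| ≤ ‖s - t‖ :=
  PiLp.norm_apply_le (s - t) k

theorem abs_knots_sub_le (s t : EuclideanSpace ℝ (Fin n)) (j : Fin (n + 2)) :
    |knots T s j - knots T t j| ≤ ‖s - t‖ := by
  rcases knot_index_cases j with rfl | rfl | ⟨i, rfl⟩
  · simp
  · simp
  · rw [knots_succ_castSucc, knots_succ_castSucc]
    exact abs_sub_le_norm s t i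

theorem exists_lipschitz_stepControl (a : Fin (n + 1) → Fin M → ℝ) :
    ∃ C : ℝ, 0 < C ∧ ∀ s ∈ feasibleTimes n T, ∀ t ∈ feasibleTimes n T,
      ‖stepControl T s a - stepControl T t a‖ ≤ C * ‖s - t‖ := by
  have hnn : ∀ i : Fin n, 0 ≤ vecNorm 1 (a i.succ - a i.castSucc) := fun i => norm_nonneg _
  refine ⟨1 + ∑ i : Fin n, vecNorm 1 (a i.succ - a i.castSucc),
    add_pos_of_pos_of_nonneg one_pos (Finset.sum_nonneg fun i _ => hnn i), fun s hs t ht => ?_⟩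
  refine (norm_stepControl_sub_le hs ht a).trans ?_
  calc ∑ i, |s i - t i| * vecNorm 1 (a i.succ - a i.castSucc)
      ≤ ∑ i : Fin n, ‖s - t‖ * vecNorm 1 (a i.succ - a i.castSucc) :=
        Finset.sum_le_sum fun i _ => mul_le_mul_of_nonneg_right (abs_sub_le_norm s t i) (hnn i)
    _ ≤ _ := by
        rw [← Finset.mul_sum, mul_comm, add_mul, one_mul]
        exact le_add_of_nonneg_left (norm_nonneg _)

theorem stepControl_mem_admissibleControls {V : Finset (Fin M → ℤ)}
    {s : EuclideanSpace ℝ (Fin n)} (hs : s ∈ feasibleTimes n T) {a : Fin (n + 1) → Fin M → ℝ}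
    (ha : ∀ k, a k ∈ controlValues V) : stepControl T s a ∈ admissibleControls T V :=
  ⟨(TV_stepControl_le (by norm_num) (by norm_num) hs a).trans_lt (EReal.coe_lt_top _),
    stepControl_mem_feasibleControls hs ha⟩

namespace IsFullRepresentation

variable {V : Finset (Fin M → ℤ)} {u : L1 M T} {a : Fin (n + 1) → Fin M → ℝ}
  {t : EuclideanSpace ℝ (Fin n)}

/-- Midpoints of the nondegenerate intervals serve as marks: knots moving by at most half the
shortest such length do not pass them. -/
theorem exists_norm_sub_le (h : IsFullRepresentation V u a t) (hT : 0 < T) :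
    ∃ ρ : ℝ, 0 < ρ ∧ ∀ s ∈ feasibleTimes n T, ‖s - t‖ ≤ ρ →
      ‖s - t‖ ≤ (n + 1) * ‖stepControl T s a - u‖ := by
  obtain ⟨ρ, hρ, hlen⟩ := exists_le_active_length (T := T) t
  refine ⟨ρ / 2, by positivity, fun s hs hst => ?_⟩
  refine norm_le_of_forall_abs_le (norm_nonneg _) fun k => ?_
  rw [h.eq_stepControl]
  refine h.abs_sub_le_norm_sub hT hs
    (m := fun J => (knots T t J.castSucc + knots T t J.succ) / 2) (fun J hJ => ?_)
    (fun J hJ => ?_) k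
  · have := hlen J hJ
    constructor <;> linarith
  · have h1 := hlen J hJ
    have h2 := abs_le.1 ((abs_knots_sub_le (T := T) s t J.castSucc).trans hst)
    have h3 := abs_le.1 ((abs_knots_sub_le (T := T) s t J.succ).trans hst)
    constructor <;> linarith [h2.1, h2.2, h3.1, h3.2]

theorem objective_le (h : IsFullRepresentation V u a t) (F : L1 M T → ℝ) {β : ℝ} (hβ : 0 ≤ β)
    {p : ℝ≥0∞} (hp : 1 < p) (hp' : p < ⊤) :
    objective F β p u ≤ ((F u + β * arcLength p a (Fin.last n) : ℝ) : EReal) :=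
  SwitchingControl.objective_le hβ (by
    rw [h.eq_stepControl]; exact TV_stepControl_le hp hp' h.monotone a)

/-- Optimality with a margin `c` carries over from the control problem to the values of `F` along
step functions. -/
theorem add_le_of_objective_add_le (h : IsFullRepresentation V u a t) (hT : 0 < T)
    {F : L1 M T → ℝ} {β : ℝ} (hβ : 0 ≤ β) {p : ℝ≥0∞} (hp : 1 < p) (hp' : p < ⊤)
    {s : EuclideanSpace ℝ (Fin n)} (hs : s ∈ feasibleTimes n T) {c : ℝ}
    (hc : objective F β p u + (c : EReal) ≤ objective F β p (stepControl T s a)) :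
    F u + c ≤ F (stepControl T s a) := by
  obtain ⟨ρ, hρ, γ, -, hρw⟩ := h.exists_stepControl_eq hT hp hp'
  have hu : u ∈ feasibleControls T V := by
    rw [h.eq_stepControl]; exact stepControl_mem_feasibleControls h.monotone h.values_mem
  have h1 := le_objective (F := F) hβ (hρw u hu (by simpa using hρ)).1
  have h2 := SwitchingControl.objective_le (F := F) hβ (TV_stepControl_le hp hp' hs a)
  have h3 := (add_le_add h1 le_rfl).trans (hc.trans h2)
  rw [← EReal.coe_add, EReal.coe_le_coe_iff] at h3
  linarith

/-- A feasible control close to `u` either has a much larger objective than `u`, or it arises from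
`u` by moving the switching times. -/
theorem objective_dichotomy (h : IsFullRepresentation V u a t) (hT : 0 < T)
    {F : L1 M T → ℝ} (hF : LowerSemicontinuousAt F u) {β : ℝ} (hβ : 0 < β) {p : ℝ≥0∞}
    (hp : 1 < p) (hp' : p < ⊤) :
    ∃ ρ : ℝ, 0 < ρ ∧ ∃ γ : ℝ, 0 < γ ∧ ∀ w ∈ feasibleControls T V, ‖w - u‖ < ρ →
      objective F β p u + (γ : EReal) ≤ objective F β p w ∨
      ∃ s ∈ feasibleTimes n T, w = stepControl T s a ∧ ‖s - t‖ ≤ (n + 1) * ‖w - u‖ ∧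
        ∀ c : ℝ, F u + c ≤ F w → objective F β p u + (c : EReal) ≤ objective F β p w := by
  obtain ⟨ρ, hρ, γ, hγ, hρw⟩ := h.exists_stepControl_eq hT hp hp'
  have hβγ : 0 < β * γ := mul_pos hβ hγ
  -- `F` may drop by at most `βγ/2` near `u`, which leaves half of the gain `βγ` as margin.
  obtain ⟨r, hr, hrF⟩ := Metric.eventually_nhds_iff.1
    (hF (F u - β * γ / 2) (by linarith))
  refine ⟨min ρ r, lt_min hρ hr, β * γ / 2, by linarith, fun w hw hwu => ?_⟩
  obtain ⟨hTV, hstep⟩ := hρw w hw (hwu.trans_le (min_le_left _ _))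
  have hobj := h.objective_le F hβ.le hp hp'
  rcases lt_or_ge (TV p w) ((arcLength p a (Fin.last n) + γ : ℝ) : EReal) with hlt | hge
  · obtain ⟨s, hs, hws, hst⟩ := hstep hlt
    refine Or.inr ⟨s, hs, hws, norm_le_of_forall_abs_le (norm_nonneg _) hst, fun c hc => ?_⟩
    refine (add_le_add hobj le_rfl).trans (le_trans ?_ (le_objective hβ.le hTV))
    rw [← EReal.coe_add, EReal.coe_le_coe_iff]
    linarith
  · refine Or.inl ((add_le_add hobj le_rfl).trans (le_trans ?_ (le_objective hβ.le hge)))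
    rw [← EReal.coe_add, EReal.coe_le_coe_iff]
    have := hrF (y := w) (by rw [dist_eq_norm]; exact hwu.trans_le (min_le_right _ _))
    linarith

theorem isLocalMinOn_iff (h : IsFullRepresentation V u a t) (hT : 0 < T)
    {F : L1 M T → ℝ} (hF : LowerSemicontinuousAt F u) {β : ℝ} (hβ : 0 < β) {p : ℝ≥0∞}
    (hp : 1 < p) (hp' : p < ⊤) :
    IsLocalMinOn (objective F β p) (feasibleControls T V) u ↔
      IsLocalMinOn (fun s => F (stepControl T s a)) (feasibleTimes n T) t := by
  constructor
  · intro hmin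
    obtain ⟨C, hC, hlip⟩ := exists_lipschitz_stepControl (T := T) a
    have htend : Tendsto (fun s => stepControl T s a) (𝓝[feasibleTimes n T] t)
        (𝓝[feasibleControls T V] u) := by
      refine tendsto_nhdsWithin_iff.2 ⟨?_, ?_⟩
      · rw [h.eq_stepControl, tendsto_iff_norm_sub_tendsto_zero]
        have h0 : Tendsto (fun s => C * ‖s - t‖) (𝓝[feasibleTimes n T] t) (𝓝 0) := by
          have hc : Continuous fun s => C * ‖s - t‖ := by fun_prop
          simpa using (hc.tendsto t).mono_left nhdsWithin_le_nhds
        refine squeeze_zero' (Eventually.of_forall fun _ => norm_nonneg _) ?_ h0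
        filter_upwards [self_mem_nhdsWithin] with s hs using hlip s hs t h.monotone
      · filter_upwards [self_mem_nhdsWithin] with s hs
        exact stepControl_mem_feasibleControls hs h.values_mem
    filter_upwards [htend.eventually hmin, self_mem_nhdsWithin] with s hs hsT
    rw [← h.eq_stepControl]
    simpa using h.add_le_of_objective_add_le hT hβ.le hp hp' hsT (c := 0) (by simpa using hs)
  · intro hmin
    obtain ⟨δ, hδ, hball⟩ := Metric.mem_nhdsWithin_iff.1 hmin
    obtain ⟨ρ, hρ, γ, hγ, hdich⟩ := h.objective_dichotomy hT hF hβ hp hp'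
    have hn : (0 : ℝ) < n + 1 := by positivity
    refine Metric.mem_nhdsWithin_iff.2 ⟨min ρ (δ / (n + 1)), lt_min hρ (by positivity), ?_⟩
    rintro w ⟨hwb, hw⟩
    rw [Metric.mem_ball, dist_eq_norm] at hwb
    rcases hdich w hw (hwb.trans_le (min_le_left _ _)) with hlarge | ⟨s, hs, rfl, hst, hobj⟩
    · refine le_trans ?_ hlarge
      exact le_add_of_nonneg_right (EReal.coe_nonneg.2 hγ.le)
    · have hsδ : s ∈ Metric.ball t δ := by
        rw [Metric.mem_ball, dist_eq_norm]
        refine hst.trans_lt ?_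
        rw [mul_comm, ← lt_div_iff₀ hn]
        exact hwb.trans_le (min_le_right _ _)
      have hle : F (stepControl T t a) ≤ F (stepControl T s a) := hball ⟨hsδ, hs⟩
      rw [← h.eq_stepControl] at hle
      simpa using hobj 0 (by simpa using hle)

theorem quadraticGrowth_iff (h : IsFullRepresentation V u a t) (hT : 0 < T)
    {F : L1 M T → ℝ} (hF : LowerSemicontinuousAt F u) {β : ℝ} (hβ : 0 < β) {p : ℝ≥0∞}
    (hp : 1 < p) (hp' : p < ⊤) :
    QuadraticGrowthP V F β p u ↔ QuadraticGrowthST F a t := by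
  obtain ⟨C, hC, hlip⟩ := exists_lipschitz_stepControl (T := T) a
  have hn : (0 : ℝ) < n + 1 := by positivity
  constructor
  · rintro ⟨ε, hε, η, hη, hgrowth⟩
    obtain ⟨ρ, hρ, hlow⟩ := h.exists_norm_sub_le hT
    -- The factor `(n + 1) ^ 2` comes from `‖s - t‖ ≤ (n + 1) ‖v^{s,a} - u‖`; the radius `ε / C`
    -- keeps `v^{s,a}` within `ε` of `u`.
    refine ⟨min ρ (ε / C), lt_min hρ (by positivity), η / (n + 1) ^ 2, by positivity,
      fun s hs hst => ?_⟩
    have h1 := hlow s hs (hst.trans (min_le_left _ _))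
    have h2 : ‖stepControl T s a - u‖ ≤ ε := by
      have h3 := hlip s hs t h.monotone
      rw [← h.eq_stepControl] at h3
      refine h3.trans ?_
      rw [mul_comm, ← le_div_iff₀ hC]
      exact hst.trans (min_le_right _ _)
    have h3 := h.add_le_of_objective_add_le hT hβ.le hp hp' hs
      (hgrowth _ (stepControl_mem_admissibleControls hs h.values_mem) h2)
    rw [← h.eq_stepControl]
    have h4 : ‖s - t‖ ^ 2 ≤ (n + 1) ^ 2 * ‖stepControl T s a - u‖ ^ 2 := by
      rw [← mul_pow]
      exact pow_le_pow_left₀ (norm_nonneg _) h1 2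
    have h5 : η / (n + 1) ^ 2 / 2 * ‖s - t‖ ^ 2 ≤ η / 2 * ‖stepControl T s a - u‖ ^ 2 := by
      refine (mul_le_mul_of_nonneg_left h4 (by positivity)).trans (le_of_eq ?_)
      field_simp
    linarith
  · rintro ⟨ε, hε, η, hη, hgrowth⟩
    obtain ⟨ρ, hρ, γ, hγ, hdich⟩ := h.objective_dichotomy hT hF hβ hp hp'
    -- `ρ / 2` gives the strict inequality for the dichotomy, radius 1 lets the fixed margin `γ`
    -- dominate the quadratic term, and `ε / (n + 1)` keeps `s` within `ε` of `t`. The constant `η /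
    -- C ^ 2` reflects `‖w - u‖ ≤ C ‖s - t‖`.
    refine ⟨min (min (ρ / 2) 1) (ε / (n + 1)), by positivity, min (η / C ^ 2) γ, by positivity,
      fun w hw hwu => ?_⟩
    have hw1 : ‖w - u‖ ≤ ρ / 2 := hwu.trans ((min_le_left _ _).trans (min_le_left _ _))
    have hw2 : ‖w - u‖ ≤ 1 := hwu.trans ((min_le_left _ _).trans (min_le_right _ _))
    have hw3 : ‖w - u‖ ≤ ε / (n + 1) := hwu.trans (min_le_right _ _)
    rcases hdich w hw.2 (by linarith) with hlarge | ⟨s, hs, rfl, hst, hobj⟩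
    · refine le_trans (add_le_add le_rfl (EReal.coe_le_coe_iff.2 ?_)) hlarge
      have h1 : ‖w - u‖ ^ 2 ≤ 1 := pow_le_one₀ (norm_nonneg _) hw2
      have h2 : min (η / C ^ 2) γ ≤ γ := min_le_right _ _
      calc min (η / C ^ 2) γ / 2 * ‖w - u‖ ^ 2 ≤ γ / 2 * 1 := by gcongr
        _ ≤ γ := by linarith
    · refine hobj _ ?_
      have hsε : ‖s - t‖ ≤ ε := by
        refine hst.trans ?_
        rw [mul_comm, ← le_div_iff₀ hn]
        exact hw3
      have h1 := hgrowth s hs hsε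
      have h2 := hlip s hs t h.monotone
      rw [← h.eq_stepControl] at h1 h2
      have h3 : ‖stepControl T s a - u‖ ^ 2 ≤ C ^ 2 * ‖s - t‖ ^ 2 := by
        rw [← mul_pow]
        exact pow_le_pow_left₀ (norm_nonneg _) h2 2
      have h4 : min (η / C ^ 2) γ ≤ η / C ^ 2 := min_le_left _ _
      have h5 : min (η / C ^ 2) γ / 2 * ‖stepControl T s a - u‖ ^ 2 ≤ η / 2 * ‖s - t‖ ^ 2 := by
        calc min (η / C ^ 2) γ / 2 * ‖stepControl T s a - u‖ ^ 2
            ≤ η / C ^ 2 / 2 * (C ^ 2 * ‖s - t‖ ^ 2) := by gcongr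
          _ = η / 2 * ‖s - t‖ ^ 2 := by field_simp
      linarith

end IsFullRepresentation

end Equivalence

end SwitchingControl

end

theorem mainTheorem1 {M : ℕ} {T : ℝ} (hT : 0 < T) (V : Finset (Fin M → ℤ))
    (F : SwitchingControl.L1 M T → ℝ) (hFbdd : BddBelow (Set.range F))
    (hFlsc : LowerSemicontinuous F) (hFdiff : SwitchingControl.GateauxDifferentiable F)
    (β : ℝ) (hβ : 0 < β) (p : ℝ≥0∞) (hp : 1 < p) (hp' : p < ⊤)
    (u : SwitchingControl.L1 M T) (hu : u ∈ SwitchingControl.admissibleControls T V)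
    (n : ℕ) (a : Fin (n + 1) → Fin M → ℝ) (t : EuclideanSpace ℝ (Fin n))
    (hrep : SwitchingControl.IsFullRepresentation V u a t) :
    (IsLocalMinOn (SwitchingControl.objective F β p) (SwitchingControl.feasibleControls T V) u ↔
      IsLocalMinOn (fun s => F (SwitchingControl.stepControl T s a))
        (SwitchingControl.feasibleTimes n T) t) ∧
    (SwitchingControl.QuadraticGrowthP V F β p u ↔
      SwitchingControl.QuadraticGrowthST F a t) :=
  ⟨hrep.isLocalMinOn_iff hT (hFlsc u) hβ hp hp', hrep.quadraticGrowth_iff hT (hFlsc u) hβ hp hp'⟩
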